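/- Let $q>0$ be real, $q\neq 1$, $h=\sqrt q-1/\sqrt q$, $\kappa=q-q^{-1}$, let indices run over $-,0,+$ and sum over repeated indices. Let $g_{ij}=g^{ij}$ be the matrix with nonzero entries $g_{-+}=1/\sqrt q$, $g_{00}=1$, $g_{+-}=\sqrt q$. Let $\hat R$ be the braid matrix of $SO_q(3)$, with nonzero entries $\hat R^{--}_{--}=\hat R^{++}_{++}=q$, $\hat R^{-0}_{-0}=\hat R^{0+}_{0+}=\kappa$, $\hat R^{-0}_{0-}=\hat R^{0-}_{-0}=\hat R^{0+}_{+0}=\hat R^{+0}_{0+}=\hat R^{00}_{00}=1$, $\hat R^{-+}_{-+}=\kappa(1-q^{-1})$, $\hat R^{-+}_{00}=\hat R^{00}_{-+}=-\kappa/\sqrt q$, $\hat R^{-+}_{+-}=\hat R^{+-}_{-+}=q^{-1}$, and let $\hat R=q\mathcal P_s-q^{-1}\mathcal P_a+q^{-2}\mathcal P_t$ be its spectral decomposition. Let $\mathcal A$ be the unital $\mathbb C$-algebra generated by $x^-,x^0,x^+,\Lambda^{\pm1},r^{\pm1},(x^0)^{-1}$ with relations $x^-x^0=q\,x^0x^-$,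 $x^+x^0=q^{-1}x^0x^+$, $x^+x^--x^-x^+=h(x^0)^2$, $x^i\Lambda=q\Lambda x^i$, $r^2=g_{ij}x^ix^j$, $rx^i=x^ir$, $r\Lambda=q\Lambda r$, and those saying that $\Lambda^{-1},r^{-1},(x^0)^{-1}$ are two-sided inverses. Let $\{d,\Omega^*(\mathcal A)\}$ be the universal differential calculus over $\mathcal A$ modulo the differential ideal generated by the relations ($\xi^i=dx^i$) $$x^i\xi^j=q\hat R^{ij}_{kl}\,\xi^kx^l,\qquad d\Lambda=0,\qquad r\xi^i=q\,\xi^ir,\qquad r\,dr=q\,dr\,r .$$ Put $\theta^a=\Lambda^{-1}\theta^a_i\,\xi^i$, with (rows $a=-,0,+$, columns $i=-,0,+$) $$(\theta^a_i)=\begin{pmatrix}(x^0)^{-1}&0&0\\ \sqrt q(q+1)(rx^0)^{-1}x^+&r^{-1}&0\\ -\sqrt q\,q(q+1)(r^2x^0)^{-1}(x^+)^2&-(q+1)r^{-2}x^+&r^{-2}x^0\end{pmatrix},$$ $$\lambda_-=h^{-1}q\Lambda(x^0)^{-1}x^+,\qquad \lambda_0=-h^{-1}\sqrt q\,\Lambda(x^0)^{-1}r,\qquad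 \lambda_+=-h^{-1}\Lambda(x^0)^{-1}x^-,$$ and $e_af=[\lambda_a,f]$ for $f\in\mathcal A$. Then: 1. The $\theta^a$ form a frame: $f\theta^a=\theta^af$ for all $f\in\mathcal A$, and $(\theta^a)$ is a basis of the left $\mathcal A$-module $\Omega^1(\mathcal A)$. 2. The $e_a$ are dual to the $\theta^a$: there are left $\mathcal A$-linear maps $\omega\mapsto\omega(e_b)$ from $\Omega^1(\mathcal A)$ to $\mathcal A$ with $df(e_b)=e_bf$ for all $f\in\mathcal A$ and $\theta^a(e_b)=\delta^a_b$; moreover $df=(e_af)\,\theta^a$ for all $f\in\mathcal A$. 3. The matrix $(\theta^a_i)$ has a two-sided inverse $(e^i_a)$ with entries in $\mathcal A$, and it satisfies $e_ax^i=q\Lambda e^i_a$, the $RTT$-relations $$\hat R^{ij}_{kl}\,e^k_ae^l_b=e^i_ce^j_d\,\hat R^{cd}_{ab},$$ and the $gTT$-relations $$g^{ab}e^i_ae^j_b=r^2g^{ij},\qquad g_{ij}e^i_ae^j_b=r^2g_{ab}.$$ 4. In $\Omega^2(\mathcal A)$ one has $\mathcal P_t{}^{ab}_{cd}\theta^c\theta^d=0$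 and $\mathcal P_s{}^{ab}_{cd}\theta^c\theta^d=0$, the same relations as those of the $\xi^i$: $\mathcal P_t{}^{ij}_{kl}\xi^k\xi^l=0$ and $\mathcal P_s{}^{ij}_{kl}\xi^k\xi^l=0$. 5. There is a unique $\mathcal A$-bilinear map $g_0:\Omega^1(\mathcal A)\otimes_{\mathcal A}\Omega^1(\mathcal A)\to\mathcal A$ with $g_0(\xi^i\otimes\xi^j)=g^{ij}r^2\Lambda^2$, and it satisfies $g_0(\theta^a\otimes\theta^b)=q\,g^{ab}$, that is, $g^{ab}$ up to normalization. -/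

import Mathlib

/-!
Quantum Euclidean space of dimension three. Throughout, `q` is a real parameter, the ground field
is `ℂ`, and the indices `-, 0, +` are the elements `0, 1, 2` of `Fin 3`.
-/

noncomputable section

namespace QEuclid

/-! ### The braid matrix, the metric matrix and the projectors of `SO_q(3)` -/

/-- `√q` as a complex number. -/
def rootq (q : ℝ) : ℂ := ((Real.sqrt q : ℝ) : ℂ)

/-- `h = √q - 1/√q`. -/
def h (q : ℝ) : ℂ := rootq q - (rootq q)⁻¹

/-- The covariant metric matrix `g_{ij} = g^{ij}` (it is its own inverse); its nonzero entries are
`g_{-+} = 1/√q`, `g_{00} = 1`, `g_{+-} = √q`. -/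
def g (q : ℝ) : Matrix (Fin 3) (Fin 3) ℂ :=
  !![0, 0, (rootq q)⁻¹; 0, 1, 0; rootq q, 0, 0]

/-- The braid matrix `R̂^{ij}_{kl}` of `SO_q(3)`, with row `(i, j)` and column `(k, l)`. -/
def Rhat (q : ℝ) : Matrix (Fin 3 × Fin 3) (Fin 3 × Fin 3) ℂ := fun ij kl =>
  let κ : ℂ := (q : ℂ) - (q : ℂ)⁻¹
  match ij, kl with
  | (0, 0), (0, 0) => q
  | (0, 1), (0, 1) => κ
  | (0, 1), (1, 0) => 1
  | (1, 0), (0, 1) => 1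
  | (0, 2), (0, 2) => κ * (1 - (q : ℂ)⁻¹)
  | (0, 2), (1, 1) => -κ * (rootq q)⁻¹
  | (0, 2), (2, 0) => (q : ℂ)⁻¹
  | (1, 1), (0, 2) => -κ * (rootq q)⁻¹
  | (1, 1), (1, 1) => 1
  | (2, 0), (0, 2) => (q : ℂ)⁻¹
  | (1, 2), (1, 2) => κ
  | (1, 2), (2, 1) => 1
  | (2, 1), (1, 2) => 1
  | (2, 2), (2, 2) => q
  | _, _ => 0

/-- The spectral projector of `R̂` for the eigenvalue `q`: deformed symmetric trace-free
projector. The spectral decomposition is `R̂ = q P_s - q⁻¹ P_a + q⁻² P_t`. -/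
def Ps (q : ℝ) : Matrix (Fin 3 × Fin 3) (Fin 3 × Fin 3) ℂ :=
  (((q : ℂ) + (q : ℂ)⁻¹) * ((q : ℂ) - ((q : ℂ) ^ 2)⁻¹))⁻¹ •
    ((Rhat q + (q : ℂ)⁻¹ • (1 : Matrix (Fin 3 × Fin 3) (Fin 3 × Fin 3) ℂ)) *
      (Rhat q - ((q : ℂ) ^ 2)⁻¹ • (1 : Matrix (Fin 3 × Fin 3) (Fin 3 × Fin 3) ℂ)))

/-- The spectral projector of `R̂` for the eigenvalue `q⁻²`: deformed trace projector. -/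
def Pt (q : ℝ) : Matrix (Fin 3 × Fin 3) (Fin 3 × Fin 3) ℂ :=
  ((((q : ℂ) ^ 2)⁻¹ - (q : ℂ)) * (((q : ℂ) ^ 2)⁻¹ + (q : ℂ)⁻¹))⁻¹ •
    ((Rhat q - (q : ℂ) • (1 : Matrix (Fin 3 × Fin 3) (Fin 3 × Fin 3) ℂ)) *
      (Rhat q + (q : ℂ)⁻¹ • (1 : Matrix (Fin 3 × Fin 3) (Fin 3 × Fin 3) ℂ)))

/-! ### The extended algebra of functions -/

/-- Generators: the coordinates `x^-, x^0, x^+`, the dilatation `Λ` and its inverse, the radius `r`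
and its inverse, and the inverse of `x^0`. -/
inductive Gen : Type
  | x (i : Fin 3)
  | dil
  | dilInv
  | rad
  | radInv
  | zInv

/-- A generator as an element of the free algebra. -/
def gen (u : Gen) : FreeAlgebra ℂ Gen := FreeAlgebra.ι ℂ u

/-- Defining relations of the extended algebra of functions on quantum Euclidean space. The radius
`r`, as the square root of the central element `g_{ij} x^i x^j` (of degree two under `Λ`), commutes
with the coordinates and has degree one under `Λ`. -/
inductive FunRel (q : ℝ) : FreeAlgebra ℂ Gen → FreeAlgebra ℂ Gen → Prop
  | xm_xz : FunRel q (gen (.x 0) * gen (.x 1)) ((q : ℂ) • (gen (.x 1) * gen (.x 0)))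
  | xp_xz : FunRel q (gen (.x 2) * gen (.x 1)) ((q : ℂ)⁻¹ • (gen (.x 1) * gen (.x 2)))
  | xp_xm : FunRel q (gen (.x 2) * gen (.x 0) - gen (.x 0) * gen (.x 2))
      (h q • gen (.x 1) ^ 2)
  | x_dil (i : Fin 3) : FunRel q (gen (.x i) * gen .dil) ((q : ℂ) • (gen .dil * gen (.x i)))
  | dil_dilInv : FunRel q (gen .dil * gen .dilInv) 1
  | dilInv_dil : FunRel q (gen .dilInv * gen .dil) 1
  | rad_sq : FunRel q (gen .rad ^ 2) (∑ i, ∑ j, g q i j • (gen (.x i) * gen (.x j)))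
  | rad_x (i : Fin 3) : FunRel q (gen .rad * gen (.x i)) (gen (.x i) * gen .rad)
  | rad_dil : FunRel q (gen .rad * gen .dil) ((q : ℂ) • (gen .dil * gen .rad))
  | rad_radInv : FunRel q (gen .rad * gen .radInv) 1
  | radInv_rad : FunRel q (gen .radInv * gen .rad) 1
  | xz_zInv : FunRel q (gen (.x 1) * gen .zInv) 1
  | zInv_xz : FunRel q (gen .zInv * gen (.x 1)) 1

/-- The algebra `A` of functions on quantum Euclidean space, extended by
`Λ, Λ⁻¹, r, r⁻¹, (x^0)⁻¹`. -/
def Fun (q : ℝ) : Type := RingQuot (FunRel q)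

instance (q : ℝ) : Ring (Fun q) := inferInstanceAs (Ring (RingQuot (FunRel q)))

instance (q : ℝ) : Algebra ℂ (Fun q) := inferInstanceAs (Algebra ℂ (RingQuot (FunRel q)))

/-- The quotient map from the free algebra to `A`. -/
def toFun (q : ℝ) : FreeAlgebra ℂ Gen →ₐ[ℂ] Fun q := RingQuot.mkAlgHom ℂ (FunRel q)

/-- The coordinates `x^i`. -/
def x (q : ℝ) (i : Fin 3) : Fun q := toFun q (gen (.x i))

/-- `Λ`. -/
def dil (q : ℝ) : Fun q := toFun q (gen .dil)

/-- `Λ⁻¹`. -/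
def dilInv (q : ℝ) : Fun q := toFun q (gen .dilInv)

/-- `r`. -/
def rad (q : ℝ) : Fun q := toFun q (gen .rad)

/-- `r⁻¹`. -/
def radInv (q : ℝ) : Fun q := toFun q (gen .radInv)

/-- `(x^0)⁻¹`. -/
def zInv (q : ℝ) : Fun q := toFun q (gen .zInv)

/-! ### The free differential graded algebra on the generators -/

/-- The free algebra on the generators `u` (as `Sum.inl u`) and their differentials `du` (as
`Sum.inr u`). -/
abbrev FreeForms : Type := FreeAlgebra ℂ (Gen ⊕ Gen)

/-- A generator `u` in the free differential graded algebra. -/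
def fgen (u : Gen) : FreeForms := FreeAlgebra.ι ℂ (Sum.inl u)

/-- The differential `du` of a generator in the free differential graded algebra. -/
def fdgen (u : Gen) : FreeForms := FreeAlgebra.ι ℂ (Sum.inr u)

/-- The degree-zero part of the free differential graded algebra. -/
def incl : FreeAlgebra ℂ Gen →ₐ[ℂ] FreeForms := FreeAlgebra.lift ℂ fgen

/-- The grading automorphism, `(-1)^p` on `p`-forms. -/
def sgn : FreeForms →ₐ[ℂ] FreeForms := FreeAlgebra.lift ℂ (Sum.elim fgen fun u => -fdgen u)

/-- `ω ↦ [[(-1)^p ω, dω], [0, ω]]`; it is multiplicative exactly because `d` is a graded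
derivation. -/
def dMat : FreeForms →ₐ[ℂ] Matrix (Fin 2) (Fin 2) FreeForms :=
  FreeAlgebra.lift ℂ (Sum.elim (fun u => !![fgen u, fdgen u; 0, fgen u])
    fun u => !![-fdgen u, 0; 0, fdgen u])

/-- The differential of the free differential graded algebra: the graded derivation with
`u ↦ du ↦ 0`. -/
def fd : FreeForms →ₗ[ℂ] FreeForms where
  toFun ω := dMat ω 0 1
  map_add' _ _ := by simp
  map_smul' _ _ := by simp

theorem dMat_eq (ω : FreeForms) : dMat ω = !![sgn ω, fd ω; 0, ω] := by
  have key : dMat ω 0 0 = sgn ω ∧ dMat ω 1 0 = 0 ∧ dMat ω 1 1 = ω := by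
    induction ω using FreeAlgebra.induction with
    | grade0 c => simp [Matrix.algebraMap_matrix_apply]
    | grade1 u => cases u <;> simp [dMat, sgn, fgen, fdgen]
    | mul a b ha hb => simp [Matrix.mul_apply, Fin.sum_univ_two, ha, hb]
    | add a b ha hb => simp [ha, hb]
  ext i j
  fin_cases i <;> fin_cases j <;> simp [key, fd]

theorem fd_mul (a b : FreeForms) : fd (a * b) = fd a * b + sgn a * fd b := by
  have hm := congrFun (congrFun (map_mul dMat a b) 0) 1
  simp only [dMat_eq, Matrix.mul_apply, Fin.sum_univ_two] at hm
  simpa [add_comm] using hm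

theorem fd_algebraMap (c : ℂ) : fd (algebraMap ℂ FreeForms c) = 0 := by
  simp [fd, Matrix.algebraMap_matrix_apply]

@[simp] theorem fd_fgen (u : Gen) : fd (fgen u) = fdgen u := by simp [fd, dMat, fgen]

@[simp] theorem fd_fdgen (u : Gen) : fd (fdgen u) = 0 := by simp [fd, dMat, fdgen]

@[simp] theorem sgn_fgen (u : Gen) : sgn (fgen u) = fgen u := by simp [sgn, fgen]

@[simp] theorem sgn_fdgen (u : Gen) : sgn (fdgen u) = -fdgen u := by simp [sgn, fdgen]

theorem sgn_incl (f : FreeAlgebra ℂ Gen) : sgn (incl f) = incl f := by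
  have e : sgn.comp incl = incl := by
    ext u
    simp [incl, sgn, fgen]
  exact DFunLike.congr_fun e f

theorem sgn_fd (a : FreeForms) : sgn (fd a) = -fd (sgn a) := by
  induction a using FreeAlgebra.induction with
  | grade0 c => simp [fd_algebraMap]
  | grade1 u =>
    cases u with
    | inl u => exact (by simp : sgn (fd (fgen u)) = -fd (sgn (fgen u)))
    | inr u => exact (by simp : sgn (fd (fdgen u)) = -fd (sgn (fdgen u)))
  | mul a b ha hb =>
    simp only [fd_mul, map_add, map_mul, ha, hb]
    noncomm_ring
  | add a b ha hb => simp [ha, hb, add_comm]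

theorem fd_fd (a : FreeForms) : fd (fd a) = 0 := by
  induction a using FreeAlgebra.induction with
  | grade0 c => simp [fd_algebraMap]
  | grade1 u =>
    cases u with
    | inl u => exact (by simp : fd (fd (fgen u)) = 0)
    | inr u => exact (by simp : fd (fd (fdgen u)) = 0)
  | mul a b ha hb => simp [fd_mul, ha, hb, sgn_fd]
  | add a b ha hb => simp [ha, hb]

/-! ### The differential calculus -/

/-- The relations of the calculus: those of `A`, the covariant relations
`x^i dx^j = q R̂^{ij}_{kl} dx^k x^l`, the relation `dΛ = 0`, and the relations `r ω = q ω r`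
for `ω = dx^i, dr` (the square root of `r² ω = q² ω r²`). -/
inductive BaseRel (q : ℝ) : FreeForms → FreeForms → Prop
  | ofFun {a b : FreeAlgebra ℂ Gen} : FunRel q a b → BaseRel q (incl a) (incl b)
  | x_dx (i j : Fin 3) : BaseRel q (fgen (.x i) * fdgen (.x j))
      ((q : ℂ) • ∑ k, ∑ l, Rhat q (i, j) (k, l) • (fdgen (.x k) * fgen (.x l)))
  | d_dil : BaseRel q (fdgen .dil) 0
  | rad_dx (i : Fin 3) : BaseRel q (fgen .rad * fdgen (.x i))
      ((q : ℂ) • (fdgen (.x i) * fgen .rad))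
  | rad_drad : BaseRel q (fgen .rad * fdgen .rad) ((q : ℂ) • (fdgen .rad * fgen .rad))

/-- The relations of the calculus together with their differentials. -/
inductive FormRel (q : ℝ) : FreeForms → FreeForms → Prop
  | base {a b : FreeForms} : BaseRel q a b → FormRel q a b
  | diff {a b : FreeForms} : BaseRel q a b → FormRel q (fd a) (fd b)

/-- The algebra of forms `Ω*(A)`: the universal differential graded algebra over `A` modulo the
differential ideal generated by the relations of the calculus. -/
def Forms (q : ℝ) : Type := RingQuot (FormRel q)

instance (q : ℝ) : Ring (Forms q) := inferInstanceAs (Ring (RingQuot (FormRel q)))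

instance (q : ℝ) : Algebra ℂ (Forms q) := inferInstanceAs (Algebra ℂ (RingQuot (FormRel q)))

/-- The quotient map onto `Ω*(A)`. -/
def toForms (q : ℝ) : FreeForms →ₐ[ℂ] Forms q := RingQuot.mkAlgHom ℂ (FormRel q)

theorem toForms_rel {q : ℝ} {a b : FreeForms} (hab : FormRel q a b) :
    toForms q a = toForms q b := RingQuot.mkAlgHom_rel ℂ hab

theorem toForms_surjective (q : ℝ) : Function.Surjective (toForms q) :=
  RingQuot.mkAlgHom_surjective ℂ (FormRel q)

theorem sgn_baseRel {q : ℝ} {a b : FreeForms} (hab : BaseRel q a b) :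
    (sgn a = a ∧ sgn b = b) ∨ (sgn a = -a ∧ sgn b = -b) := by
  cases hab with
  | ofFun _ => exact .inl ⟨sgn_incl _, sgn_incl _⟩
  | x_dx i j => right; simp [-Complex.coe_smul]
  | d_dil => right; simp [-Complex.coe_smul]
  | rad_dx i => right; simp [-Complex.coe_smul]
  | rad_drad => right; simp [-Complex.coe_smul]

theorem toForms_sgn_rel {q : ℝ} {a b : FreeForms} (hab : FormRel q a b) :
    toForms q (sgn a) = toForms q (sgn b) := by
  cases hab with
  | base hab =>
    have e := toForms_rel (.base hab)
    rcases sgn_baseRel hab with ⟨ha, hb⟩ | ⟨ha, hb⟩ <;> simp [ha, hb, e]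
  | diff hab =>
    have e := toForms_rel (.diff hab)
    rcases sgn_baseRel hab with ⟨ha, hb⟩ | ⟨ha, hb⟩ <;> simp [sgn_fd, ha, hb, e]

theorem toForms_fd_rel {q : ℝ} {a b : FreeForms} (hab : FormRel q a b) :
    toForms q (fd a) = toForms q (fd b) := by
  cases hab with
  | base hab => exact toForms_rel (.diff hab)
  | diff hab => simp [fd_fd]

/-- The matrix form `ω ↦ [[(-1)^p ω, dω], [0, ω]]` of the differential on `Ω*(A)`. -/
def dMatForms (q : ℝ) : Forms q →ₐ[ℂ] Matrix (Fin 2) (Fin 2) (Forms q) :=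
  RingQuot.liftAlgHom ℂ ⟨((toForms q).mapMatrix).comp dMat, by
    intro a b hab
    ext i j
    fin_cases i <;> fin_cases j <;>
      simp [dMat_eq, toForms_rel hab, toForms_sgn_rel hab, toForms_fd_rel hab]⟩

/-- The differential `d` of `Ω*(A)`. -/
def d (q : ℝ) : Forms q →ₗ[ℂ] Forms q where
  toFun ω := dMatForms q ω 0 1
  map_add' _ _ := by simp
  map_smul' _ _ := by simp

theorem dMatForms_toForms (q : ℝ) (a : FreeForms) :
    dMatForms q (toForms q a) = (dMat a).map (toForms q) :=
  RingQuot.liftAlgHom_mkAlgHom_apply ℂ _ _ a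

theorem d_toForms (q : ℝ) (a : FreeForms) : d q (toForms q a) = toForms q (fd a) := by
  change dMatForms q (toForms q a) 0 1 = _
  rw [dMatForms_toForms, dMat_eq]
  simp

theorem d_d (q : ℝ) (ω : Forms q) : d q (d q ω) = 0 := by
  obtain ⟨a, rfl⟩ := toForms_surjective q ω
  simp [d_toForms, fd_fd]

/-- The inclusion of `A` in `Ω*(A)` as functions. -/
def ofFun (q : ℝ) : Fun q →ₐ[ℂ] Forms q :=
  RingQuot.liftAlgHom ℂ ⟨(toForms q).comp incl, fun _ _ hab => toForms_rel (.base (.ofFun hab))⟩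

theorem ofFun_toFun (q : ℝ) (a : FreeAlgebra ℂ Gen) :
    ofFun q (toFun q a) = toForms q (incl a) :=
  RingQuot.liftAlgHom_mkAlgHom_apply ℂ _ _ a

/-- The Leibniz rule `d(f ω) = df ω + f dω`. -/
theorem d_ofFun_mul (q : ℝ) (f : Fun q) (ω : Forms q) :
    d q (ofFun q f * ω) = d q (ofFun q f) * ω + ofFun q f * d q ω := by
  obtain ⟨a, rfl⟩ := RingQuot.mkAlgHom_surjective ℂ (FunRel q) f
  obtain ⟨b, rfl⟩ := toForms_surjective q ω
  have e : ofFun q ((RingQuot.mkAlgHom ℂ (FunRel q)) a) = toForms q (incl a) := ofFun_toFun q a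
  rw [e, ← map_mul]
  rw [d_toForms, d_toForms, d_toForms, fd_mul, sgn_incl, map_add, map_mul, map_mul]

/-- `Ω*(A)` as a left `A`-module. -/
instance (q : ℝ) : Module (Fun q) (Forms q) := Module.compHom (Forms q) (ofFun q).toRingHom

theorem smul_def (q : ℝ) (f : Fun q) (ω : Forms q) : f • ω = ofFun q f * ω := rfl

/-- The 1-forms `Ω¹(A)`: finite sums of `f dg` with `f, g` in `A`. -/
def OneForms (q : ℝ) : Submodule (Fun q) (Forms q) :=
  Submodule.span (Fun q) (Set.range fun f : Fun q => d q (ofFun q f))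

/-- The differential `d : A → Ω¹(A)`. -/
def dFun (q : ℝ) (f : Fun q) : OneForms q := ⟨d q (ofFun q f), Submodule.subset_span ⟨f, rfl⟩⟩

theorem mul_ofFun_mem (q : ℝ) {ω : Forms q} (hω : ω ∈ OneForms q) (f : Fun q) :
    ω * ofFun q f ∈ OneForms q := by
  induction hω using Submodule.span_induction with
  | mem ω hω =>
    obtain ⟨k, rfl⟩ := hω
    have e : d q (ofFun q k) * ofFun q f = d q (ofFun q (k * f)) - k • d q (ofFun q f) := by
      rw [map_mul, d_ofFun_mul, smul_def, add_sub_cancel_right]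
    simp only [e]
    exact Submodule.sub_mem _ (dFun q (k * f)).2 (Submodule.smul_mem _ _ (dFun q f).2)
  | zero => simp
  | add a b _ _ ha hb => rw [add_mul]; exact Submodule.add_mem _ ha hb
  | smul k a _ ha =>
    rw [smul_def, mul_assoc]
    exact Submodule.smul_mem _ k ha

/-- The right action of `A` on `Ω¹(A)`. -/
def mulRight (q : ℝ) (ω : OneForms q) (f : Fun q) : OneForms q :=
  ⟨(ω : Forms q) * ofFun q f, mul_ofFun_mem q ω.2 f⟩

/-- An `A`-bilinear map `Ω¹(A) ⊗_A Ω¹(A) → A`, given as an `A`-balanced biadditive map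
`(ω, η) ↦ g(ω ⊗ η)`. -/
structure Metric (q : ℝ) where
  val : OneForms q → OneForms q → Fun q
  add_left : ∀ ω ω' η, val (ω + ω') η = val ω η + val ω' η
  add_right : ∀ ω η η', val ω (η + η') = val ω η + val ω η'
  balanced : ∀ ω (f : Fun q) η, val (mulRight q ω f) η = val ω (f • η)
  smul_left : ∀ (f : Fun q) ω η, val (f • ω) η = f * val ω η
  mul_right : ∀ ω η (f : Fun q), val ω (mulRight q η f) = val ω η * f

/-! ### The frame and the inner derivations -/

/-- `ξ^i = dx^i`. -/
def ξ (q : ℝ) (i : Fin 3) : OneForms q := dFun q (x q i)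

/-- The matrix `θ^a_i`, with row `a` and column `i`. -/
def thetaMat (q : ℝ) : Matrix (Fin 3) (Fin 3) (Fun q) :=
  !![zInv q, 0, 0;
    (rootq q * (q + 1)) • (radInv q * zInv q * x q 2), radInv q, 0;
    (-(rootq q * q * (q + 1))) • (radInv q ^ 2 * zInv q * x q 2 ^ 2),
      (-((q : ℂ) + 1)) • (radInv q ^ 2 * x q 2), radInv q ^ 2 * x q 1]

/-- `θ^a = Λ⁻¹ θ^a_i ξ^i`. -/
def θ (q : ℝ) (a : Fin 3) : OneForms q := ∑ i, (dilInv q * thetaMat q a i) • ξ q i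

/-- The elements `λ_-, λ_0, λ_+` of `A`. -/
def lam (q : ℝ) : Fin 3 → Fun q :=
  ![((h q)⁻¹ * q) • (dil q * zInv q * x q 2),
    (-((h q)⁻¹ * rootq q)) • (dil q * zInv q * rad q),
    (-(h q)⁻¹) • (dil q * zInv q * x q 0)]

/-- The inner derivation `e_a = [λ_a, ·]`. -/
def innerDer (q : ℝ) (a : Fin 3) (f : Fun q) : Fun q := lam q a * f - f * lam q a

end QEuclid

end

/-!
The frame is controlled by two facts about the algebra `A`. Firstly, the matrix `θ^a_i` is inverse
to an explicit matrix `e^i_a` over `A` (`frameMat`) with `[λ_a, x^i] = q Λ e^i_a`. Secondly, this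
matrix satisfies `x^i e^j_b = R̂^{ij}_{kl} e^k_b x^l` (`braid_frameMat_mul_x`), that is, its columns
commute with the coordinates exactly as the differentials do, up to the powers of `q` that `Λ`
absorbs. These and the `RTT`- and `gTT`-relations are identities in `A`. Since `x^- x^+` and
`x^+ x^-` are combinations of `r²` and `(x^0)²` and the other generators commute up to scalars,
they are checked by bringing every word to a normal order (`normalOrder`, `normalOrder_cancel`).

The forms `θ^a` generate the one-forms. With `ξ^i = e^i_a Λ θ^a`, the relation
`x^i ξ^j = q R̂^{ij}_{kl} ξ^k x^l` says that the commutators `[x^i, θ^a]`, contracted with `e^j_a Λ`,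
are killed by the invertible matrix `R̂`; so they vanish, and `θ^a` commutes with `A` (`smul_θ`).
Then `f ↦ df` and `f ↦ (e_a f) θ^a` are both derivations; they agree on the `x^i`, on `Λ`, and,
because `r² = g_{ij} x^i x^j` and `r dr = q dr r` with `q ≠ -1`, on `r`; hence everywhere
(`defect_eq_zero`).

The forms `θ^a` are independent. Sending `f` to the scalar matrix `f` and `df` to `e_b f` in the
corner defines a homomorphism from the free differential graded algebra to `2 × 2` matrices over
`A`. It respects all the relations of the calculus, those in degree one by the second fact and those
in degree two because its corner squares to zero, so it yields left linear maps `ev` on one-forms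
with `df ↦ e_b f` and `θ^a ↦ δ^a_b`.

Differentiating `x^i ξ^j = q R̂^{ij}_{kl} ξ^k x^l` shows that `ξ^i ξ^j` is an eigenvector of `R̂` for
`-q⁻¹`, and the `RTT`-relations carry this over to `θ^a θ^b` (`braid_θ_mul_θ`). Finally, a bilinear
map on one-forms is determined by its values on the basis `θ^a`, which commutes with `A`, and any
central values there define one; by the `gTT`-relations the values `q g^{ab}` on the `θ^a` give the
prescribed values on the `ξ^i`.
-/

noncomputable section

namespace QEuclid

/-! ### Scalars and the braid matrix -/

section Scalars

variable {q : ℝ}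

theorem rootq_sq (hq : 0 < q) : (q : ℂ) = rootq q ^ 2 := by
  rw [rootq, ← Complex.ofReal_pow, Real.sq_sqrt hq.le]

theorem rootq_ne_zero (hq : 0 < q) : rootq q ≠ 0 := by
  simpa [rootq] using (Real.sqrt_pos.2 hq).ne'

theorem coe_add_one_ne_zero (hq : 0 < q) : (q : ℂ) + 1 ≠ 0 := by
  exact_mod_cast (by positivity : q + 1 ≠ 0)

theorem rootq_sq_add_one_ne_zero (hq : 0 < q) : rootq q ^ 2 + 1 ≠ 0 :=
  rootq_sq hq ▸ coe_add_one_ne_zero hq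

theorem rootq_sq_sub_one_ne_zero (hq : 0 < q) (hq1 : q ≠ 1) : rootq q ^ 2 - 1 ≠ 0 := by
  rw [← rootq_sq hq]
  exact_mod_cast sub_ne_zero.2 hq1

theorem h_eq (hq : 0 < q) : h q = (rootq q ^ 2 - 1) / rootq q := by
  have := rootq_ne_zero hq
  rw [h]
  field_simp

theorem forall_fin_three {P : Fin 3 → Prop} : (∀ i, P i) ↔ P 0 ∧ P 1 ∧ P 2 :=
  ⟨fun H => ⟨H 0, H 1, H 2⟩, fun ⟨h0, h1, h2⟩ i => by fin_cases i <;> assumption⟩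

theorem Rhat_symm (q : ℝ) (a b c d : Fin 3) : Rhat q (a, b) (c, d) = Rhat q (c, d) (a, b) := by
  revert a b c d
  simp [forall_fin_three, Rhat]

variable {M : Type*} [AddCommGroup M] [Module ℂ M] (v : Fin 3 → Fin 3 → M)

/-- The contraction `N^{ij}_{kl} v^{kl}` of a pair of indices with a matrix. -/
def contract (N : Matrix (Fin 3 × Fin 3) (Fin 3 × Fin 3) ℂ) (v : Fin 3 → Fin 3 → M)
    (i j : Fin 3) : M :=
  ∑ k, ∑ l, N (i, j) (k, l) • v k l

theorem contract_apply (N : Matrix (Fin 3 × Fin 3) (Fin 3 × Fin 3) ℂ) (i j : Fin 3) :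
    contract N v i j = ∑ p, N (i, j) p • v p.1 p.2 :=
  (Fintype.sum_prod_type fun p => N (i, j) p • v p.1 p.2).symm

theorem contract_mul (N N' : Matrix (Fin 3 × Fin 3) (Fin 3 × Fin 3) ℂ) :
    contract (N * N') v = contract N (contract N' v) := by
  ext i j
  simp only [contract_apply, Matrix.mul_apply, Finset.sum_smul, Finset.smul_sum, smul_smul]
  exact Finset.sum_comm

theorem contract_add (N N' : Matrix (Fin 3 × Fin 3) (Fin 3 × Fin 3) ℂ) :
    contract (N + N') v = contract N v + contract N' v := by
  ext i j
  simp [contract, add_smul, Finset.sum_add_distrib]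

theorem contract_smul (c : ℂ) (N : Matrix (Fin 3 × Fin 3) (Fin 3 × Fin 3) ℂ) :
    contract (c • N) v = c • contract N v := by
  ext i j
  simp [contract, smul_smul, Finset.smul_sum]

theorem contract_one : contract 1 v = v := by
  ext i j
  simp [contract_apply, Matrix.one_apply, ite_smul]

/-- The contraction of a pair of indices with the braid matrix, `R̂^{ij}_{kl} v^{kl}`. -/
def braid (q : ℝ) : (Fin 3 → Fin 3 → M) → Fin 3 → Fin 3 → M := contract (Rhat q)

theorem braid_apply (i j : Fin 3) :
    braid q v i j = ∑ k, ∑ l, Rhat q (i, j) (k, l) • v k l := rfl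

theorem braid_smul {A : Type*} [Ring A] [Module A M] [SMulCommClass ℂ A M] (c : A)
    (i j : Fin 3) : braid q (fun k l => c • v k l) i j = c • braid q v i j := by
  simp only [braid_apply, Finset.smul_sum, smul_comm _ c]

theorem braid_smul_const {A : Type*} [Ring A] [Algebra ℂ A] [Module A M] [IsScalarTower ℂ A M]
    (f : Fin 3 → Fin 3 → A) (m : M) (i j : Fin 3) :
    braid q (fun k l => f k l • m) i j = braid q f i j • m := by
  simp only [braid_apply, Finset.sum_smul, smul_assoc]

theorem braid_sum (w : Fin 3 → Fin 3 → Fin 3 → M) (i j : Fin 3) :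
    braid q (fun k l => ∑ b, w b k l) i j = ∑ b, braid q (w b) i j := by
  simp only [braid_apply, Finset.smul_sum]
  rw [Finset.sum_comm (s := Finset.univ) (t := Finset.univ)
    (f := fun b k => ∑ l, Rhat q (i, j) (k, l) • w b k l)]
  exact Finset.sum_congr rfl fun k _ => Finset.sum_comm

theorem braid_sub (w : Fin 3 → Fin 3 → M) (i j : Fin 3) :
    braid q (fun k l => v k l - w k l) i j = braid q v i j - braid q w i j := by
  simp [braid_apply, smul_sub]

/-- An eigenvector of the braid matrix for the eigenvalue `-q⁻¹` is killed by the projector onto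
the eigenvalue `q`. -/
theorem contract_Ps_eq_zero (hv : braid q v = (-(q : ℂ)⁻¹) • v) : contract (Ps q) v = 0 := by
  -- The factor that kills `v` is moved to the right, where it acts first.
  have comm : (Rhat q + (q : ℂ)⁻¹ • 1) * (Rhat q - ((q : ℂ) ^ 2)⁻¹ • 1) =
      (Rhat q - ((q : ℂ) ^ 2)⁻¹ • 1) * (Rhat q + (q : ℂ)⁻¹ • 1) := by
    refine Commute.eq ?_
    refine .sub_right (.add_left (.refl _) ?_) ?_
    · exact (Commute.one_left _).smul_left _
    · exact (Commute.one_right _).smul_right _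
  have e : contract (Rhat q + (q : ℂ)⁻¹ • 1) v = 0 := by
    rw [contract_add, contract_smul, contract_one, ← braid, hv, neg_smul, neg_add_cancel]
  rw [Ps, comm, contract_smul, contract_mul, e]
  ext i j
  simp [contract]

/-- An eigenvector of the braid matrix for the eigenvalue `-q⁻¹` is killed by the projector onto
the eigenvalue `q⁻²`. -/
theorem contract_Pt_eq_zero (hv : braid q v = (-(q : ℂ)⁻¹) • v) : contract (Pt q) v = 0 := by
  have e : contract (Rhat q + (q : ℂ)⁻¹ • 1) v = 0 := by
    rw [contract_add, contract_smul, contract_one, ← braid, hv, neg_smul, neg_add_cancel]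
  rw [Pt, contract_smul, contract_mul, e]
  ext i j
  simp [contract]

theorem braid_zero_zero (hq : 0 < q) : braid q v 0 0 = rootq q ^ 2 • v 0 0 := by
  simp [braid_apply, Fin.sum_univ_three, Rhat, rootq_sq hq]

theorem braid_zero_one (hq : 0 < q) :
    braid q v 0 1 = (rootq q ^ 2 - (rootq q ^ 2)⁻¹) • v 0 1 + v 1 0 := by
  simp [braid_apply, Fin.sum_univ_three, Rhat, rootq_sq hq]

theorem braid_one_zero : braid q v 1 0 = v 0 1 := by
  simp [braid_apply, Fin.sum_univ_three, Rhat]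

theorem braid_zero_two (hq : 0 < q) :
    braid q v 0 2 = ((rootq q ^ 2 - (rootq q ^ 2)⁻¹) * (1 - (rootq q ^ 2)⁻¹)) • v 0 2
      + (-(rootq q ^ 2 - (rootq q ^ 2)⁻¹) * (rootq q)⁻¹) • v 1 1 + (rootq q ^ 2)⁻¹ • v 2 0 := by
  simp [braid_apply, Fin.sum_univ_three, Rhat, rootq_sq hq]

theorem braid_one_one (hq : 0 < q) :
    braid q v 1 1 = (-(rootq q ^ 2 - (rootq q ^ 2)⁻¹) * (rootq q)⁻¹) • v 0 2 + v 1 1 := by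
  simp [braid_apply, Fin.sum_univ_three, Rhat, rootq_sq hq]

theorem braid_two_zero (hq : 0 < q) : braid q v 2 0 = (rootq q ^ 2)⁻¹ • v 0 2 := by
  simp [braid_apply, Fin.sum_univ_three, Rhat, rootq_sq hq]

theorem braid_one_two (hq : 0 < q) :
    braid q v 1 2 = (rootq q ^ 2 - (rootq q ^ 2)⁻¹) • v 1 2 + v 2 1 := by
  simp [braid_apply, Fin.sum_univ_three, Rhat, rootq_sq hq]

theorem braid_two_one : braid q v 2 1 = v 1 2 := by
  simp [braid_apply, Fin.sum_univ_three, Rhat]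

theorem braid_two_two (hq : 0 < q) : braid q v 2 2 = rootq q ^ 2 • v 2 2 := by
  simp [braid_apply, Fin.sum_univ_three, Rhat, rootq_sq hq]

/-- The braid matrix is invertible: up to the order of its rows, it is triangular. -/
theorem eq_zero_of_braid_eq_zero (hq : 0 < q) (hv : ∀ i j, braid q v i j = 0) (i j : Fin 3) :
    v i j = 0 := by
  have hs := rootq_ne_zero hq
  revert i j
  simp only [forall_fin_three, braid_zero_zero v hq, braid_zero_one v hq, braid_one_zero,
    braid_zero_two v hq, braid_one_one v hq, braid_two_zero v hq, braid_one_two v hq,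
    braid_two_one, braid_two_two v hq] at hv ⊢
  obtain ⟨⟨h00, h01, h02⟩, ⟨h10, h11, h12⟩, h20, h21, h22⟩ := hv
  have e00 : v 0 0 = 0 := by simpa [hs] using h00
  have e22 : v 2 2 = 0 := by simpa [hs] using h22
  have e02 : v 0 2 = 0 := by simpa [hs] using h20
  have e11 : v 1 1 = 0 := by simpa [e02] using h11
  simp_all

end Scalars

/-! ### Commutation rules in the algebra of functions -/

section Commutation

variable {q : ℝ}

theorem mul_inv_of_mul_eq_smul {A : Type*} [Ring A] [Algebra ℂ A] {a a' b : A} {k : ℂ}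
    (hk : k ≠ 0) (ha : a * a' = 1) (ha' : a' * a = 1) (hab : b * a = k • (a * b)) :
    b * a' = k⁻¹ • (a' * b) := by
  calc b * a' = k⁻¹ • (a' * (k • (a * b)) * a') := by
        simp [smul_smul, hk, ← mul_assoc, ha']
    _ = k⁻¹ • (a' * b) := by rw [← hab]; simp [mul_assoc, ha]

theorem inv_mul_of_mul_eq_smul {A : Type*} [Ring A] [Algebra ℂ A] {a b b' : A} {k : ℂ}
    (hk : k ≠ 0) (hb : b * b' = 1) (hb' : b' * b = 1) (hab : b * a = k • (a * b)) :
    b' * a = k⁻¹ • (a * b') := by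
  calc b' * a = k⁻¹ • (b' * (k • (a * b)) * b') := by
        simp [smul_smul, hk, mul_assoc, hb]
    _ = k⁻¹ • (a * b') := by rw [← hab]; simp [← mul_assoc, hb']

theorem mul_mul_of_mul_eq_smul {A : Type*} [Ring A] [Algebra ℂ A] {a b : A} {k : ℂ}
    (hab : b * a = k • (a * b)) (t : A) : b * (a * t) = k • (a * (b * t)) := by
  rw [← mul_assoc, hab, smul_mul_assoc, mul_assoc]

theorem toFun_rel {a b : FreeAlgebra ℂ Gen} (hab : FunRel q a b) : toFun q a = toFun q b :=
  RingQuot.mkAlgHom_rel ℂ hab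

theorem toFun_surjective (q : ℝ) : Function.Surjective (toFun q) :=
  RingQuot.mkAlgHom_surjective ℂ (FunRel q)

theorem dil_dilInv : dil q * dilInv q = 1 := by
  simpa [dil, dilInv] using toFun_rel (q := q) .dil_dilInv

theorem dilInv_dil : dilInv q * dil q = 1 := by
  simpa [dil, dilInv] using toFun_rel (q := q) .dilInv_dil

theorem rad_radInv : rad q * radInv q = 1 := by
  simpa [rad, radInv] using toFun_rel (q := q) .rad_radInv

theorem radInv_rad : radInv q * rad q = 1 := by
  simpa [rad, radInv] using toFun_rel (q := q) .radInv_rad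

theorem xz_zInv : x q 1 * zInv q = 1 := by
  simpa [x, zInv] using toFun_rel (q := q) .xz_zInv

theorem zInv_xz : zInv q * x q 1 = 1 := by
  simpa [x, zInv] using toFun_rel (q := q) .zInv_xz

theorem x_dil (hq : 0 < q) (i : Fin 3) : x q i * dil q = rootq q ^ 2 • (dil q * x q i) := by
  have := toFun_rel (q := q) (.x_dil i)
  rwa [rootq_sq hq, map_mul, map_smul, map_mul] at this

theorem rad_dil (hq : 0 < q) : rad q * dil q = rootq q ^ 2 • (dil q * rad q) := by
  have := toFun_rel (q := q) .rad_dil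
  rwa [rootq_sq hq, map_mul, map_smul, map_mul] at this

theorem x_rad (i : Fin 3) : x q i * rad q = rad q * x q i := by
  have := toFun_rel (q := q) (.rad_x i)
  rw [map_mul, map_mul] at this
  exact this.symm

theorem x_radInv (i : Fin 3) : x q i * radInv q = radInv q * x q i := by
  simpa using mul_inv_of_mul_eq_smul one_ne_zero rad_radInv radInv_rad
    ((x_rad i).trans (one_smul ℂ (rad q * x q i)).symm)

theorem xm_xz (hq : 0 < q) : x q 0 * x q 1 = rootq q ^ 2 • (x q 1 * x q 0) := by
  have := toFun_rel (q := q) .xm_xz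
  rwa [rootq_sq hq, map_mul, map_smul, map_mul] at this

theorem xp_xz (hq : 0 < q) : x q 2 * x q 1 = (rootq q ^ 2)⁻¹ • (x q 1 * x q 2) := by
  have := toFun_rel (q := q) .xp_xz
  rwa [rootq_sq hq, map_mul, map_smul, map_mul] at this

theorem xp_xm_sub : x q 2 * x q 0 - x q 0 * x q 2 = h q • (x q 1 * x q 1) := by
  have := toFun_rel (q := q) .xp_xm
  rwa [map_sub, map_mul, map_mul, map_smul, pow_two, map_mul] at this

theorem rad_sq_eq : rad q * rad q = ∑ i, ∑ j, g q i j • (x q i * x q j) := by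
  have := toFun_rel (q := q) .rad_sq
  simp only [pow_two, map_mul, map_sum, map_smul] at this
  exact this

/-- The product `x^- x^+` is a combination of the squares of `r` and `x^0`. -/
theorem xm_xp (hq : 0 < q) : x q 0 * x q 2 = (rootq q / (rootq q ^ 2 + 1)) • (rad q * rad q)
    - (rootq q ^ 3 / (rootq q ^ 2 + 1)) • (x q 1 * x q 1) := by
  have hs := rootq_ne_zero hq
  have hs1 := rootq_sq_add_one_ne_zero hq
  have e := xp_xm_sub (q := q)
  rw [sub_eq_iff_eq_add] at e
  rw [rad_sq_eq]
  simp only [Fin.sum_univ_three, g, Matrix.of_apply, Matrix.cons_val, zero_smul, one_smul, e,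
    h_eq hq, add_zero, zero_add]
  match_scalars
  · field_simp
    ring
  · field_simp
    ring

theorem xp_xm (hq : 0 < q) : x q 2 * x q 0 = (rootq q / (rootq q ^ 2 + 1)) • (rad q * rad q)
    - ((rootq q)⁻¹ / (rootq q ^ 2 + 1)) • (x q 1 * x q 1) := by
  have hs := rootq_ne_zero hq
  have hs1 := rootq_sq_add_one_ne_zero hq
  rw [sub_eq_iff_eq_add.1 (xp_xm_sub (q := q)), xm_xp hq, h_eq hq]
  match_scalars
  · field_simp
    ring
  · field_simp

end Commutation

/-! ### Normal ordering -/

section NormalOrder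

variable {q : ℝ}

theorem x_dilInv (hq : 0 < q) (i : Fin 3) :
    x q i * dilInv q = (rootq q ^ 2)⁻¹ • (dilInv q * x q i) :=
  mul_inv_of_mul_eq_smul (pow_ne_zero 2 (rootq_ne_zero hq)) dil_dilInv dilInv_dil (x_dil hq i)

theorem rad_dilInv (hq : 0 < q) : rad q * dilInv q = (rootq q ^ 2)⁻¹ • (dilInv q * rad q) :=
  mul_inv_of_mul_eq_smul (pow_ne_zero 2 (rootq_ne_zero hq)) dil_dilInv dilInv_dil (rad_dil hq)

theorem radInv_dil (hq : 0 < q) : radInv q * dil q = (rootq q ^ 2)⁻¹ • (dil q * radInv q) :=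
  inv_mul_of_mul_eq_smul (pow_ne_zero 2 (rootq_ne_zero hq)) rad_radInv radInv_rad (rad_dil hq)

theorem radInv_dilInv (hq : 0 < q) : radInv q * dilInv q = rootq q ^ 2 • (dilInv q * radInv q) := by
  simpa only [inv_inv] using inv_mul_of_mul_eq_smul
    (inv_ne_zero (pow_ne_zero 2 (rootq_ne_zero hq))) rad_radInv radInv_rad (rad_dilInv hq)

theorem zInv_dil (hq : 0 < q) : zInv q * dil q = (rootq q ^ 2)⁻¹ • (dil q * zInv q) :=
  inv_mul_of_mul_eq_smul (pow_ne_zero 2 (rootq_ne_zero hq)) xz_zInv zInv_xz (x_dil hq 1)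

theorem zInv_dilInv (hq : 0 < q) : zInv q * dilInv q = rootq q ^ 2 • (dilInv q * zInv q) := by
  simpa only [inv_inv] using inv_mul_of_mul_eq_smul
    (inv_ne_zero (pow_ne_zero 2 (rootq_ne_zero hq))) xz_zInv zInv_xz (x_dilInv hq 1)

theorem zInv_rad : zInv q * rad q = rad q * zInv q := by
  simpa using inv_mul_of_mul_eq_smul one_ne_zero xz_zInv zInv_xz
    ((x_rad 1).trans (one_smul ℂ (rad q * x q 1)).symm)

theorem zInv_radInv : zInv q * radInv q = radInv q * zInv q := by
  simpa using inv_mul_of_mul_eq_smul one_ne_zero xz_zInv zInv_xz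
    ((x_radInv 1).trans (one_smul ℂ (radInv q * x q 1)).symm)

theorem xm_zInv (hq : 0 < q) : x q 0 * zInv q = (rootq q ^ 2)⁻¹ • (zInv q * x q 0) :=
  mul_inv_of_mul_eq_smul (pow_ne_zero 2 (rootq_ne_zero hq)) xz_zInv zInv_xz (xm_xz hq)

theorem xp_zInv (hq : 0 < q) : x q 2 * zInv q = rootq q ^ 2 • (zInv q * x q 2) := by
  simpa only [inv_inv] using mul_inv_of_mul_eq_smul
    (inv_ne_zero (pow_ne_zero 2 (rootq_ne_zero hq))) xz_zInv zInv_xz (xp_xz hq)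

theorem x_rad_mul (i : Fin 3) (t : Fun q) : x q i * (rad q * t) = rad q * (x q i * t) := by
  rw [← mul_assoc, x_rad, mul_assoc]

theorem x_radInv_mul (i : Fin 3) (t : Fun q) :
    x q i * (radInv q * t) = radInv q * (x q i * t) := by
  rw [← mul_assoc, x_radInv, mul_assoc]

theorem zInv_rad_mul (t : Fun q) : zInv q * (rad q * t) = rad q * (zInv q * t) := by
  rw [← mul_assoc, zInv_rad, mul_assoc]

theorem zInv_radInv_mul (t : Fun q) : zInv q * (radInv q * t) = radInv q * (zInv q * t) := by
  rw [← mul_assoc, zInv_radInv, mul_assoc]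

theorem mul_cancel_assoc {A : Type*} [Ring A] {a b : A} (hab : a * b = 1) (t : A) :
    a * (b * t) = t := by
  rw [← mul_assoc, hab, one_mul]

theorem xm_xp_mul (hq : 0 < q) (t : Fun q) : x q 0 * (x q 2 * t) =
    (rootq q / (rootq q ^ 2 + 1)) • (rad q * (rad q * t))
      - (rootq q ^ 3 / (rootq q ^ 2 + 1)) • (x q 1 * (x q 1 * t)) := by
  rw [← mul_assoc, xm_xp hq, sub_mul, smul_mul_assoc, smul_mul_assoc, mul_assoc, mul_assoc]

theorem xp_xm_mul (hq : 0 < q) (t : Fun q) : x q 2 * (x q 0 * t) =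
    (rootq q / (rootq q ^ 2 + 1)) • (rad q * (rad q * t))
      - ((rootq q)⁻¹ / (rootq q ^ 2 + 1)) • (x q 1 * (x q 1 * t)) := by
  rw [← mul_assoc, xp_xm hq, sub_mul, smul_mul_assoc, smul_mul_assoc, mul_assoc, mul_assoc]

/-- The rewriting rules with scalars that bring every word in the generators to the order
`Λ, Λ⁻¹, r, r⁻¹, x^0, (x^0)⁻¹, x^∓`, with at most one of `x^-` and `x^+` present. Each rule is given
for a product at the end and for one inside a right-associated word. An identity in `A` is then
checked by comparing the coefficients of the ordered words. -/
theorem normalOrder (hq : 0 < q) :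
    (∀ i, x q i * dil q = rootq q ^ 2 • (dil q * x q i)) ∧
    (∀ i t, x q i * (dil q * t) = rootq q ^ 2 • (dil q * (x q i * t))) ∧
    (∀ i, x q i * dilInv q = (rootq q ^ 2)⁻¹ • (dilInv q * x q i)) ∧
    (∀ i t, x q i * (dilInv q * t) = (rootq q ^ 2)⁻¹ • (dilInv q * (x q i * t))) ∧
    rad q * dil q = rootq q ^ 2 • (dil q * rad q) ∧
    (∀ t, rad q * (dil q * t) = rootq q ^ 2 • (dil q * (rad q * t))) ∧
    rad q * dilInv q = (rootq q ^ 2)⁻¹ • (dilInv q * rad q) ∧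
    (∀ t, rad q * (dilInv q * t) = (rootq q ^ 2)⁻¹ • (dilInv q * (rad q * t))) ∧
    radInv q * dil q = (rootq q ^ 2)⁻¹ • (dil q * radInv q) ∧
    (∀ t, radInv q * (dil q * t) = (rootq q ^ 2)⁻¹ • (dil q * (radInv q * t))) ∧
    radInv q * dilInv q = rootq q ^ 2 • (dilInv q * radInv q) ∧
    (∀ t, radInv q * (dilInv q * t) = rootq q ^ 2 • (dilInv q * (radInv q * t))) ∧
    zInv q * dil q = (rootq q ^ 2)⁻¹ • (dil q * zInv q) ∧
    (∀ t, zInv q * (dil q * t) = (rootq q ^ 2)⁻¹ • (dil q * (zInv q * t))) ∧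
    zInv q * dilInv q = rootq q ^ 2 • (dilInv q * zInv q) ∧
    (∀ t, zInv q * (dilInv q * t) = rootq q ^ 2 • (dilInv q * (zInv q * t))) ∧
    x q 0 * x q 1 = rootq q ^ 2 • (x q 1 * x q 0) ∧
    (∀ t, x q 0 * (x q 1 * t) = rootq q ^ 2 • (x q 1 * (x q 0 * t))) ∧
    x q 2 * x q 1 = (rootq q ^ 2)⁻¹ • (x q 1 * x q 2) ∧
    (∀ t, x q 2 * (x q 1 * t) = (rootq q ^ 2)⁻¹ • (x q 1 * (x q 2 * t))) ∧
    x q 0 * zInv q = (rootq q ^ 2)⁻¹ • (zInv q * x q 0) ∧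
    (∀ t, x q 0 * (zInv q * t) = (rootq q ^ 2)⁻¹ • (zInv q * (x q 0 * t))) ∧
    x q 2 * zInv q = rootq q ^ 2 • (zInv q * x q 2) ∧
    (∀ t, x q 2 * (zInv q * t) = rootq q ^ 2 • (zInv q * (x q 2 * t))) ∧
    x q 0 * x q 2 = (rootq q / (rootq q ^ 2 + 1)) • (rad q * rad q)
      - (rootq q ^ 3 / (rootq q ^ 2 + 1)) • (x q 1 * x q 1) ∧
    (∀ t, x q 0 * (x q 2 * t) = (rootq q / (rootq q ^ 2 + 1)) • (rad q * (rad q * t))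
      - (rootq q ^ 3 / (rootq q ^ 2 + 1)) • (x q 1 * (x q 1 * t))) ∧
    x q 2 * x q 0 = (rootq q / (rootq q ^ 2 + 1)) • (rad q * rad q)
      - ((rootq q)⁻¹ / (rootq q ^ 2 + 1)) • (x q 1 * x q 1) ∧
    (∀ t, x q 2 * (x q 0 * t) = (rootq q / (rootq q ^ 2 + 1)) • (rad q * (rad q * t))
      - ((rootq q)⁻¹ / (rootq q ^ 2 + 1)) • (x q 1 * (x q 1 * t))) :=
  ⟨x_dil hq, fun i => mul_mul_of_mul_eq_smul (x_dil hq i),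
    x_dilInv hq, fun i => mul_mul_of_mul_eq_smul (x_dilInv hq i),
    rad_dil hq, mul_mul_of_mul_eq_smul (rad_dil hq),
    rad_dilInv hq, mul_mul_of_mul_eq_smul (rad_dilInv hq),
    radInv_dil hq, mul_mul_of_mul_eq_smul (radInv_dil hq),
    radInv_dilInv hq, mul_mul_of_mul_eq_smul (radInv_dilInv hq),
    zInv_dil hq, mul_mul_of_mul_eq_smul (zInv_dil hq),
    zInv_dilInv hq, mul_mul_of_mul_eq_smul (zInv_dilInv hq),
    xm_xz hq, mul_mul_of_mul_eq_smul (xm_xz hq),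
    xp_xz hq, mul_mul_of_mul_eq_smul (xp_xz hq),
    xm_zInv hq, mul_mul_of_mul_eq_smul (xm_zInv hq),
    xp_zInv hq, mul_mul_of_mul_eq_smul (xp_zInv hq),
    xm_xp hq, xm_xp_mul hq, xp_xm hq, xp_xm_mul hq⟩

/-- The part of the normal ordering that involves no scalars: `r` is central among the
coordinates, and inverses cancel. -/
theorem normalOrder_cancel (q : ℝ) :
    (∀ i, x q i * rad q = rad q * x q i) ∧
    (∀ i t, x q i * (rad q * t) = rad q * (x q i * t)) ∧
    (∀ i, x q i * radInv q = radInv q * x q i) ∧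
    (∀ i t, x q i * (radInv q * t) = radInv q * (x q i * t)) ∧
    zInv q * rad q = rad q * zInv q ∧
    (∀ t, zInv q * (rad q * t) = rad q * (zInv q * t)) ∧
    zInv q * radInv q = radInv q * zInv q ∧
    (∀ t, zInv q * (radInv q * t) = radInv q * (zInv q * t)) ∧
    dil q * dilInv q = 1 ∧ (∀ t, dil q * (dilInv q * t) = t) ∧
    dilInv q * dil q = 1 ∧ (∀ t, dilInv q * (dil q * t) = t) ∧
    rad q * radInv q = 1 ∧ (∀ t, rad q * (radInv q * t) = t) ∧
    radInv q * rad q = 1 ∧ (∀ t, radInv q * (rad q * t) = t) ∧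
    x q 1 * zInv q = 1 ∧ (∀ t, x q 1 * (zInv q * t) = t) ∧
    zInv q * x q 1 = 1 ∧ (∀ t, zInv q * (x q 1 * t) = t) :=
  ⟨x_rad, x_rad_mul, x_radInv, x_radInv_mul, zInv_rad, zInv_rad_mul, zInv_radInv,
    zInv_radInv_mul, dil_dilInv, mul_cancel_assoc dil_dilInv, dilInv_dil,
    mul_cancel_assoc dilInv_dil, rad_radInv, mul_cancel_assoc rad_radInv, radInv_rad,
    mul_cancel_assoc radInv_rad, xz_zInv, mul_cancel_assoc xz_zInv, zInv_xz,
    mul_cancel_assoc zInv_xz⟩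

end NormalOrder

/-! ### The matrix of the frame -/

section FrameMatrix

variable {q : ℝ}

/-- The inverse `e^i_a` of the matrix `θ^a_i`, with row `i` and column `a`. -/
def frameMat (q : ℝ) : Matrix (Fin 3) (Fin 3) (Fun q) :=
  !![x q 1, 0, 0;
    (-((rootq q ^ 2 + 1) / rootq q)) • x q 2, rad q, 0;
    (-(rootq q * (rootq q ^ 2 + 1))) • (zInv q * x q 2 * x q 2),
      (rootq q ^ 2 + 1) • (rad q * zInv q * x q 2), rad q * rad q * zInv q]

theorem thetaMat_mul_frameMat (hq : 0 < q) : thetaMat q * frameMat q = 1 := by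
  have hs := rootq_ne_zero hq
  have hs1 := rootq_sq_add_one_ne_zero hq
  rw [← Matrix.ext_iff]
  simp only [forall_fin_three, Matrix.mul_apply, Fin.sum_univ_three, thetaMat, frameMat,
    Matrix.of_apply, Matrix.cons_val, mul_assoc, rootq_sq hq, normalOrder hq,
    normalOrder_cancel q, smul_mul_assoc, mul_smul_comm, pow_two (radInv q), pow_two (x q 2)]
  simp
  refine ⟨?_, ?_, ?_⟩
  all_goals match_scalars; field_simp; try ring

theorem frameMat_mul_thetaMat (hq : 0 < q) : frameMat q * thetaMat q = 1 := by
  have hs := rootq_ne_zero hq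
  have hs1 := rootq_sq_add_one_ne_zero hq
  rw [← Matrix.ext_iff]
  simp only [forall_fin_three, Matrix.mul_apply, Fin.sum_univ_three, thetaMat, frameMat,
    Matrix.of_apply, Matrix.cons_val, mul_assoc, rootq_sq hq, normalOrder hq,
    normalOrder_cancel q, smul_mul_assoc, mul_smul_comm, pow_two (radInv q), pow_two (x q 2)]
  simp
  refine ⟨?_, ?_, ?_⟩
  all_goals match_scalars; field_simp; try ring

theorem innerDer_x (hq : 0 < q) (hq1 : q ≠ 1) (a i : Fin 3) :
    innerDer q a (x q i) = (q : ℂ) • (dil q * frameMat q i a) := by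
  have hs := rootq_ne_zero hq
  have hs1 := rootq_sq_add_one_ne_zero hq
  have hs2 := rootq_sq_sub_one_ne_zero hq hq1
  revert a i
  simp only [forall_fin_three, innerDer, lam, frameMat, h_eq hq,
    Matrix.of_apply, Matrix.cons_val, mul_assoc, rootq_sq hq, normalOrder hq,
    normalOrder_cancel q, smul_mul_assoc, mul_smul_comm, mul_sub, smul_sub, mul_zero, mul_one,
    smul_zero]
  repeat' apply And.intro
  all_goals
    match_scalars <;> field_simp
    all_goals try ring

theorem braid_frameMat_mul_x (hq : 0 < q) (i j b : Fin 3) :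
    braid q (fun k l => frameMat q k b * x q l) i j = x q i * frameMat q j b := by
  have hs := rootq_ne_zero hq
  have hs1 := rootq_sq_add_one_ne_zero hq
  revert i j b
  simp only [forall_fin_three, braid_zero_zero _ hq, braid_zero_one _ hq, braid_one_zero,
    braid_zero_two _ hq, braid_one_one _ hq, braid_two_zero _ hq, braid_one_two _ hq,
    braid_two_one, braid_two_two _ hq, frameMat,
    Matrix.of_apply, Matrix.cons_val, mul_assoc, normalOrder hq,
    normalOrder_cancel q, smul_mul_assoc, mul_smul_comm, mul_sub, smul_sub, mul_zero, mul_one,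
    zero_mul, smul_zero, add_zero, zero_add, and_true, true_and]
  repeat' apply And.intro
  all_goals
    match_scalars <;> field_simp
    all_goals try ring

/-- The `RTT`-relations. -/
theorem braid_frameMat_mul_frameMat (hq : 0 < q) (i j a b : Fin 3) :
    braid q (fun k l => frameMat q k a * frameMat q l b) i j =
      braid q (fun c d => frameMat q i c * frameMat q j d) a b := by
  have hs := rootq_ne_zero hq
  have hs1 := rootq_sq_add_one_ne_zero hq
  revert i j a b
  simp only [forall_fin_three, braid_zero_zero _ hq, braid_zero_one _ hq, braid_one_zero,
    braid_zero_two _ hq, braid_one_one _ hq, braid_two_zero _ hq, braid_one_two _ hq,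
    braid_two_one, braid_two_two _ hq, frameMat,
    Matrix.of_apply, Matrix.cons_val, mul_assoc, normalOrder hq,
    normalOrder_cancel q, smul_mul_assoc, mul_smul_comm, mul_sub, mul_zero, mul_one, zero_mul,
    smul_zero, add_zero, zero_add, and_true, true_and]
  repeat' apply And.intro
  all_goals
    match_scalars
    field_simp
    try ring

theorem sum_g_frameMat_lower (hq : 0 < q) (i j : Fin 3) :
    ∑ a, ∑ b, g q a b • (frameMat q i a * frameMat q j b) = g q i j • rad q ^ 2 := by
  have hs := rootq_ne_zero hq
  have hs1 := rootq_sq_add_one_ne_zero hq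
  revert i j
  simp only [forall_fin_three, Fin.sum_univ_three, g, frameMat,
    Matrix.of_apply, Matrix.cons_val, mul_assoc, normalOrder hq, pow_two (rad q),
    normalOrder_cancel q, smul_mul_assoc, mul_smul_comm, mul_zero, mul_one, zero_mul,
    smul_zero, zero_smul, add_zero, zero_add, and_true, true_and]
  repeat' apply And.intro
  all_goals
    match_scalars
    field_simp
    try ring

theorem sum_g_frameMat_upper (hq : 0 < q) (a b : Fin 3) :
    ∑ i, ∑ j, g q i j • (frameMat q i a * frameMat q j b) = g q a b • rad q ^ 2 := by
  have hs := rootq_ne_zero hq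
  have hs1 := rootq_sq_add_one_ne_zero hq
  revert a b
  simp only [forall_fin_three, Fin.sum_univ_three, g, frameMat,
    Matrix.of_apply, Matrix.cons_val, mul_assoc, normalOrder hq, pow_two (rad q),
    normalOrder_cancel q, smul_mul_assoc, mul_smul_comm, mul_zero, mul_one, zero_mul,
    smul_zero, zero_smul, add_zero, zero_add, and_true]
  repeat' apply And.intro
  all_goals
    match_scalars
    field_simp
    try ring

theorem thetaMat_mul_dil (hq : 0 < q) (a i : Fin 3) :
    (q : ℂ) • (thetaMat q a i * dil q) = dil q * thetaMat q a i := by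
  have hs := rootq_ne_zero hq
  revert a i
  simp only [forall_fin_three, thetaMat, Matrix.of_apply, Matrix.cons_val, mul_assoc, rootq_sq hq,
    normalOrder hq, smul_mul_assoc, mul_smul_comm, mul_zero, zero_mul, smul_zero,
    pow_two (radInv q), pow_two (x q 2), and_true]
  repeat' apply And.intro
  all_goals
    match_scalars
    field_simp

theorem thetaMat_mul_rad (a i : Fin 3) : thetaMat q a i * rad q = rad q * thetaMat q a i := by
  revert a i
  simp only [forall_fin_three, thetaMat, Matrix.of_apply, Matrix.cons_val, mul_assoc,
    normalOrder_cancel q, smul_mul_assoc, mul_smul_comm, mul_zero, zero_mul, pow_two (radInv q),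
    pow_two (x q 2), and_true]

theorem frameMat_mul_dil (hq : 0 < q) (i a : Fin 3) :
    frameMat q i a * dil q = (q : ℂ) • (dil q * frameMat q i a) := by
  have hs := rootq_ne_zero hq
  revert a i
  simp only [forall_fin_three, frameMat, Matrix.of_apply, Matrix.cons_val, mul_assoc, rootq_sq hq,
    normalOrder hq, smul_mul_assoc, mul_smul_comm, mul_zero, zero_mul, smul_zero,
    and_true, true_and]
  repeat' apply And.intro
  all_goals
    match_scalars
    field_simp

theorem frameMat_mul_rad (i a : Fin 3) : frameMat q i a * rad q = rad q * frameMat q i a := by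
  revert a i
  simp only [forall_fin_three, frameMat, Matrix.of_apply, Matrix.cons_val, mul_assoc,
    normalOrder_cancel q, smul_mul_assoc, mul_smul_comm, mul_zero, zero_mul, and_true]

theorem innerDer_dil (hq : 0 < q) (a : Fin 3) : innerDer q a (dil q) = 0 := by
  have hs := rootq_ne_zero hq
  revert a
  simp only [forall_fin_three, innerDer, lam, Matrix.cons_val, mul_assoc,
    normalOrder hq, smul_mul_assoc, mul_smul_comm]
  repeat' apply And.intro
  all_goals
    match_scalars
    field_simp
    try ring

theorem rad_mul_innerDer_rad (hq : 0 < q) (a : Fin 3) :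
    rad q * innerDer q a (rad q) = (q : ℂ) • (innerDer q a (rad q) * rad q) := by
  have hs := rootq_ne_zero hq
  revert a
  simp only [forall_fin_three, innerDer, lam, Matrix.cons_val, mul_assoc, rootq_sq hq,
    normalOrder hq, normalOrder_cancel q, smul_mul_assoc, mul_smul_comm, mul_sub, sub_mul]
  repeat' apply And.intro
  all_goals
    match_scalars
    field_simp

end FrameMatrix

/-! ### The commutation rules of one-forms with functions -/

section Forms

variable {q : ℝ}

instance (q : ℝ) : IsScalarTower ℂ (Fun q) (Forms q) :=
  ⟨fun c f ω => by simp [smul_def]⟩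

instance (q : ℝ) : IsScalarTower (Fun q) (Forms q) (Forms q) :=
  ⟨fun f ω η => by simp [smul_def, mul_assoc]⟩

theorem ofFun_x (i : Fin 3) : ofFun q (x q i) = toForms q (fgen (.x i)) := by
  simp [x, ofFun_toFun, incl, gen]

theorem ofFun_dil : ofFun q (dil q) = toForms q (fgen .dil) := by
  simp [dil, ofFun_toFun, incl, gen]

theorem ofFun_rad : ofFun q (rad q) = toForms q (fgen .rad) := by
  simp [rad, ofFun_toFun, incl, gen]

theorem coe_ξ (i : Fin 3) : (ξ q i : Forms q) = toForms q (fdgen (.x i)) := by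
  change d q (ofFun q (x q i)) = _
  rw [ofFun_x, d_toForms, fd_fgen]

theorem coe_dFun (f : Fun q) : (dFun q f : Forms q) = d q (ofFun q f) := rfl

theorem d_ofFun_algebraMap (c : ℂ) : d q (ofFun q (algebraMap ℂ (Fun q) c)) = 0 := by
  rw [AlgHom.commutes, ← AlgHom.commutes (toForms q), d_toForms, fd_algebraMap, map_zero]

theorem d_ofFun_mul_ofFun (f f' : Fun q) :
    d q (ofFun q (f * f')) = d q (ofFun q f) * ofFun q f' + f • d q (ofFun q f') := by
  rw [map_mul, d_ofFun_mul, smul_def]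

theorem d_dil : d q (ofFun q (dil q)) = 0 := by
  rw [ofFun_dil, d_toForms, fd_fgen, toForms_rel (.base .d_dil), map_zero]

theorem dil_smul_ξ (i : Fin 3) :
    (q : ℂ) • dil q • (ξ q i : Forms q) = (ξ q i : Forms q) * ofFun q (dil q) := by
  have e := congrArg (fun f => d q (ofFun q f)) (toFun_rel (q := q) (.x_dil i))
  simp only [map_mul (toFun q), map_smul] at e
  change d q (ofFun q (x q i * dil q)) = (q : ℂ) • d q (ofFun q (dil q * x q i)) at e
  rw [d_ofFun_mul_ofFun, d_ofFun_mul_ofFun, d_dil, smul_zero, add_zero, zero_mul, zero_add] at e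
  exact e.symm

theorem rad_smul_ξ (i : Fin 3) :
    rad q • (ξ q i : Forms q) = (q : ℂ) • ((ξ q i : Forms q) * ofFun q (rad q)) := by
  rw [smul_def, ofFun_rad, coe_ξ, ← map_mul, ← map_mul, ← map_smul]
  exact toForms_rel (.base (.rad_dx i))

theorem rad_smul_drad :
    rad q • d q (ofFun q (rad q)) = (q : ℂ) • (d q (ofFun q (rad q)) * ofFun q (rad q)) := by
  rw [smul_def, ofFun_rad, d_toForms, fd_fgen, ← map_mul, ← map_mul, ← map_smul]
  exact toForms_rel (.base .rad_drad)

theorem x_smul_ξ (i j : Fin 3) : x q i • (ξ q j : Forms q) =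
    (q : ℂ) • braid q (fun k l => (ξ q k : Forms q) * ofFun q (x q l)) i j := by
  simp only [smul_def, ofFun_x, coe_ξ, braid_apply, ← map_mul, ← map_smul, ← map_sum]
  exact toForms_rel (.base (.x_dx i j))

/-- A subalgebra closed under inverses and containing the `x^i`, `Λ` and `r` is everything. -/
theorem mem_of_gens (S : Subalgebra ℂ (Fun q)) (hx : ∀ i, x q i ∈ S) (hdil : dil q ∈ S)
    (hrad : rad q ∈ S) (hinv : ∀ a b, a * b = 1 → b * a = 1 → a ∈ S → b ∈ S) (f : Fun q) :
    f ∈ S := by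
  obtain ⟨a, rfl⟩ := toFun_surjective q f
  induction a using FreeAlgebra.induction with
  | grade0 c => rw [AlgHom.commutes]; exact S.algebraMap_mem c
  | grade1 u =>
    cases u with
    | x i => exact hx i
    | dil => exact hdil
    | dilInv => exact hinv _ _ dil_dilInv dilInv_dil hdil
    | rad => exact hrad
    | radInv => exact hinv _ _ rad_radInv radInv_rad hrad
    | zInv => exact hinv _ _ xz_zInv zInv_xz (hx 1)
  | mul a b ha hb => rw [map_mul]; exact S.mul_mem ha hb
  | add a b ha hb => rw [map_add]; exact S.add_mem ha hb

end Forms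

/-! ### The frame commutes with functions -/

section Frame

variable {q : ℝ}

theorem coe_θ (a : Fin 3) :
    (θ q a : Forms q) = ∑ i, (dilInv q * thetaMat q a i) • (ξ q i : Forms q) := by
  simp [θ]

theorem frameMat_smul_eq_zero (hq : 0 < q) {M : Type*} [AddCommGroup M] [Module (Fun q) M]
    {v : Fin 3 → M} (hv : ∀ i, ∑ a, frameMat q i a • v a = 0) (a : Fin 3) : v a = 0 := by
  have e : ∑ i, thetaMat q a i • ∑ b, frameMat q i b • v b = v a := by
    simp only [Finset.smul_sum, smul_smul]
    rw [Finset.sum_comm]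
    simp only [← Finset.sum_smul, ← Matrix.mul_apply, thetaMat_mul_frameMat hq,
      Matrix.one_apply, one_smul, ite_smul, zero_smul, Finset.sum_ite_eq,
      Finset.mem_univ, if_true]
  simpa only [hv, smul_zero, Finset.sum_const_zero] using e.symm

theorem eq_zero_of_dil_smul {M : Type*} [AddCommGroup M] [Module (Fun q) M] {m : M}
    (hm : dil q • m = 0) : m = 0 := by
  simpa [smul_smul, dilInv_dil] using congrArg (dilInv q • ·) hm

/-- The differentials of the coordinates in terms of the frame. -/
theorem coe_ξ_eq_sum_θ (hq : 0 < q) (i : Fin 3) :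
    (ξ q i : Forms q) = ∑ a, (frameMat q i a * dil q) • (θ q a : Forms q) := by
  simp only [coe_θ, Finset.smul_sum, smul_smul]
  rw [Finset.sum_comm]
  simp only [mul_assoc, mul_cancel_assoc dil_dilInv, ← Finset.sum_smul, ← Matrix.mul_apply,
    frameMat_mul_thetaMat hq, Matrix.one_apply, ite_smul, zero_smul, one_smul, Finset.sum_ite_eq,
    Finset.mem_univ, if_true]

theorem dil_smul_θ (hq : 0 < q) (a : Fin 3) :
    dil q • (θ q a : Forms q) = (θ q a : Forms q) * ofFun q (dil q) := by
  simp only [coe_θ, Finset.smul_sum, Finset.sum_mul, smul_mul_assoc, ← dil_smul_ξ, smul_smul]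
  refine Finset.sum_congr rfl fun i _ => ?_
  rw [smul_comm _ (q : ℂ), smul_smul, ← smul_assoc, mul_assoc, ← mul_smul_comm,
    thetaMat_mul_dil hq, mul_cancel_assoc dil_dilInv, mul_cancel_assoc dilInv_dil]

theorem rad_smul_θ (hq : 0 < q) (a : Fin 3) :
    rad q • (θ q a : Forms q) = (θ q a : Forms q) * ofFun q (rad q) := by
  have hq0 : (q : ℂ) ≠ 0 := by exact_mod_cast hq.ne'
  have hξ (i : Fin 3) : (ξ q i : Forms q) * ofFun q (rad q) =
      (q : ℂ)⁻¹ • rad q • (ξ q i : Forms q) := by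
    rw [rad_smul_ξ, smul_smul, inv_mul_cancel₀ hq0, one_smul]
  simp only [coe_θ, Finset.smul_sum, Finset.sum_mul, smul_mul_assoc, hξ, smul_smul]
  refine Finset.sum_congr rfl fun i _ => ?_
  rw [smul_comm _ (q : ℂ)⁻¹, smul_smul, ← smul_assoc, mul_assoc, thetaMat_mul_rad, ← mul_assoc,
    ← mul_assoc, rad_dilInv hq, ← rootq_sq hq, smul_mul_assoc]

/-- The commutators of the coordinates with the frame vanish: contracted with the matrix `e^i_a Λ`,
they form a tensor killed by the braid matrix, because the entries of `e^i_a` have with the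
coordinates the same commutation rules as the differentials. -/
theorem x_smul_θ (hq : 0 < q) (i a : Fin 3) :
    x q i • (θ q a : Forms q) = (θ q a : Forms q) * ofFun q (x q i) := by
  have hq0 : (q : ℂ) ≠ 0 := by exact_mod_cast hq.ne'
  set c : Fin 3 → Fin 3 → Forms q := fun l b =>
    x q l • (θ q b : Forms q) - (θ q b : Forms q) * ofFun q (x q l) with hc
  set w : Fin 3 → Fin 3 → Forms q := fun k l => ∑ b, (frameMat q k b * dil q) • c l b with hw
  have hξx (k l : Fin 3) : (ξ q k : Forms q) * ofFun q (x q l) =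
      (q : ℂ)⁻¹ • (∑ b, (frameMat q k b * x q l) • dil q • (θ q b : Forms q)) - w k l := by
    rw [coe_ξ_eq_sum_θ hq, Finset.sum_mul, hw, Finset.smul_sum, ← Finset.sum_sub_distrib]
    refine Finset.sum_congr rfl fun b _ => ?_
    have e : (q : ℂ)⁻¹ • (frameMat q k b * x q l * dil q) = frameMat q k b * dil q * x q l := by
      rw [mul_assoc, x_dil hq, ← rootq_sq hq, mul_smul_comm, smul_smul, inv_mul_cancel₀ hq0,
        one_smul, mul_assoc]
    rw [hc, smul_sub, smul_smul, smul_smul, ← smul_assoc, e, sub_sub_cancel, smul_mul_assoc]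
  have hw0 : ∀ i j, braid q w i j = 0 := by
    intro i j
    have e := x_smul_ξ (q := q) i j
    simp only [hξx] at e
    rw [braid_sub, smul_sub, eq_sub_iff_add_eq, ← eq_sub_iff_add_eq'] at e
    have e' : braid q (fun k l => (q : ℂ)⁻¹ •
        ∑ b, (frameMat q k b * x q l) • dil q • (θ q b : Forms q)) i j =
        (q : ℂ)⁻¹ • x q i • (ξ q j : Forms q) := by
      rw [braid_smul, braid_sum, coe_ξ_eq_sum_θ hq, Finset.smul_sum (r := x q i)]
      congr 1
      refine Finset.sum_congr rfl fun b _ => ?_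
      rw [braid_smul_const (fun k l => frameMat q k b * x q l), braid_frameMat_mul_x hq,
        smul_smul, smul_smul, mul_assoc]
    rw [e', smul_smul, mul_inv_cancel₀ hq0, one_smul, sub_self] at e
    exact (smul_eq_zero.1 e).resolve_left hq0
  have hc0 := frameMat_smul_eq_zero hq (v := fun b => dil q • c i b)
    (fun k => by simpa only [hw, mul_smul] using eq_zero_of_braid_eq_zero w hq hw0 k i) a
  exact sub_eq_zero.1 (eq_zero_of_dil_smul hc0)

theorem smul_θ (hq : 0 < q) (a : Fin 3) (f : Fun q) :
    f • (θ q a : Forms q) = (θ q a : Forms q) * ofFun q f := by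
  refine (Subalgebra.mem_centralizer_iff ℂ (s := {(θ q a : Forms q)})).1
    (mem_of_gens ((Subalgebra.centralizer ℂ {(θ q a : Forms q)}).comap (ofFun q))
      ?_ ?_ ?_ ?_ f) _ rfl |>.symm
  · rintro i _ rfl
    exact (x_smul_θ hq i a).symm
  · rintro _ rfl
    exact (dil_smul_θ hq a).symm
  · rintro _ rfl
    exact (rad_smul_θ hq a).symm
  · rintro b c hbc hcb hb _ rfl
    have hb' : (θ q a : Forms q) * ofFun q b = ofFun q b * (θ q a : Forms q) := hb _ rfl
    have h1 : ofFun q b * ofFun q c = 1 := by rw [← map_mul, hbc, map_one]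
    have h2 : ofFun q c * ofFun q b = 1 := by rw [← map_mul, hcb, map_one]
    change (θ q a : Forms q) * ofFun q c = ofFun q c * (θ q a : Forms q)
    calc (θ q a : Forms q) * ofFun q c
        = ofFun q c * (ofFun q b * (θ q a : Forms q)) * ofFun q c := by
          rw [← mul_assoc (ofFun q c), h2, one_mul]
      _ = ofFun q c * (θ q a : Forms q) := by
          rw [← hb', mul_assoc, mul_assoc, h1, mul_one]

end Frame

/-! ### The differential as a sum of inner derivations -/

section Differential

variable {q : ℝ}

theorem innerDer_mul (a : Fin 3) (f f' : Fun q) :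
    innerDer q a (f * f') = innerDer q a f * f' + f * innerDer q a f' := by
  simp only [innerDer]
  noncomm_ring

theorem innerDer_add (a : Fin 3) (f f' : Fun q) :
    innerDer q a (f + f') = innerDer q a f + innerDer q a f' := by
  simp only [innerDer]
  noncomm_ring

theorem innerDer_algebraMap (a : Fin 3) (c : ℂ) :
    innerDer q a (algebraMap ℂ (Fun q) c) = 0 := by
  rw [innerDer, Algebra.commutes, sub_self]

/-- The difference between the differential and `f ↦ (e_a f) θ^a`. -/
def defect (q : ℝ) (f : Fun q) : Forms q :=
  d q (ofFun q f) - ∑ a, innerDer q a f • (θ q a : Forms q)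

theorem defect_add (f f' : Fun q) : defect q (f + f') = defect q f + defect q f' := by
  simp only [defect, map_add, innerDer_add, add_smul, Finset.sum_add_distrib]
  abel

theorem defect_algebraMap (c : ℂ) : defect q (algebraMap ℂ (Fun q) c) = 0 := by
  simp only [defect, d_ofFun_algebraMap, innerDer_algebraMap, zero_smul, Finset.sum_const_zero,
    sub_zero]

theorem defect_mul (hq : 0 < q) (f f' : Fun q) :
    defect q (f * f') = defect q f * ofFun q f' + f • defect q f' := by
  have e (a : Fin 3) : innerDer q a (f * f') • (θ q a : Forms q) =
      innerDer q a f • (θ q a : Forms q) * ofFun q f' +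
        f • innerDer q a f' • (θ q a : Forms q) := by
    rw [innerDer_mul, add_smul, mul_smul, mul_smul, smul_mul_assoc, smul_θ hq a f']
  simp only [defect, d_ofFun_mul_ofFun, e, Finset.sum_add_distrib, sub_mul, smul_sub,
    Finset.sum_mul, Finset.smul_sum]
  abel

theorem defect_smul (hq : 0 < q) (c : ℂ) (f : Fun q) : defect q (c • f) = c • defect q f := by
  rw [Algebra.smul_def, defect_mul hq, defect_algebraMap, zero_mul, zero_add, algebraMap_smul]

theorem defect_x (hq : 0 < q) (hq1 : q ≠ 1) (i : Fin 3) : defect q (x q i) = 0 := by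
  have e : d q (ofFun q (x q i)) = (ξ q i : Forms q) := rfl
  rw [defect, e, coe_ξ_eq_sum_θ hq, sub_eq_zero]
  exact Finset.sum_congr rfl fun a _ => by rw [innerDer_x hq hq1, frameMat_mul_dil hq]

theorem defect_dil (hq : 0 < q) : defect q (dil q) = 0 := by
  simp only [defect, d_dil, innerDer_dil hq, zero_smul, Finset.sum_const_zero, sub_zero]

/-- The defect of `r` vanishes because that of `r²`, which is a polynomial in the coordinates, does
and because `r` commutes with one-forms up to the factor `q ≠ -1`. -/
theorem defect_rad (hq : 0 < q) (hq1 : q ≠ 1) : defect q (rad q) = 0 := by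
  have h0 : defect q (rad q * rad q) = 0 := by
    have hx (i j : Fin 3) : defect q (x q i * x q j) = 0 := by
      rw [defect_mul hq, defect_x hq hq1, defect_x hq hq1, zero_mul, smul_zero, add_zero]
    rw [rad_sq_eq]
    simp only [Fin.sum_univ_three, defect_add, defect_smul hq, hx, smul_zero, add_zero]
  have h1 : rad q • defect q (rad q) = (q : ℂ) • (defect q (rad q) * ofFun q (rad q)) := by
    simp only [defect, smul_sub, sub_mul, rad_smul_drad, Finset.smul_sum, Finset.sum_mul]
    congr 1
    refine Finset.sum_congr rfl fun a _ => ?_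
    rw [smul_smul, rad_mul_innerDer_rad hq, smul_mul_assoc, ← smul_θ hq, smul_assoc, mul_smul]
  rw [defect_mul hq, h1] at h0
  have h2 : defect q (rad q) * ofFun q (rad q) = 0 := by
    have : ((q : ℂ) + 1) • (defect q (rad q) * ofFun q (rad q)) = 0 := by
      rw [add_smul, one_smul, add_comm, h0]
    exact (smul_eq_zero.1 this).resolve_left (coe_add_one_ne_zero hq)
  calc defect q (rad q) = defect q (rad q) * ofFun q (rad q) * ofFun q (radInv q) := by
        rw [mul_assoc, ← map_mul, rad_radInv, map_one, mul_one]
    _ = 0 := by rw [h2, zero_mul]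

theorem defect_eq_zero (hq : 0 < q) (hq1 : q ≠ 1) (f : Fun q) : defect q f = 0 := by
  let S : Subalgebra ℂ (Fun q) :=
    { carrier := {f | defect q f = 0}
      mul_mem' := fun {a b} (ha : defect q a = 0) (hb : defect q b = 0) => by
        rw [Set.mem_ofPred_eq, defect_mul hq, ha, hb, zero_mul, smul_zero, add_zero]
      add_mem' := fun {a b} (ha : defect q a = 0) (hb : defect q b = 0) => by
        rw [Set.mem_ofPred_eq, defect_add, ha, hb, add_zero]
      algebraMap_mem' := defect_algebraMap }
  refine mem_of_gens S (defect_x hq hq1) (defect_dil hq) (defect_rad hq hq1) ?_ f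
  intro a b hab hba (ha : defect q a = 0)
  have e : defect q (a * b) = 0 := by
    rw [hab, ← map_one (algebraMap ℂ (Fun q)), defect_algebraMap]
  rw [defect_mul hq, ha, zero_mul, zero_add] at e
  change defect q b = 0
  rw [← one_smul (Fun q) (defect q b), ← hba, mul_smul, e, smul_zero]

theorem dFun_eq_sum (hq : 0 < q) (hq1 : q ≠ 1) (f : Fun q) :
    dFun q f = ∑ a, innerDer q a f • θ q a := by
  refine Subtype.ext ?_
  rw [coe_dFun, sub_eq_zero.1 (defect_eq_zero hq hq1 f)]
  simp

end Differential

/-! ### Evaluation of forms on the inner derivations -/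

section Evaluation

variable {q : ℝ}

/-- A generator as an element of `A`. -/
def genFun (q : ℝ) (u : Gen) : Fun q := toFun q (gen u)

/-- The homomorphism from the free differential graded algebra to upper triangular matrices with
`f ↦ [[f, 0], [0, f]]` and `df ↦ [[0, e_b f], [0, 0]]`; the products of two one-forms are sent to
zero. -/
def evMatFree (q : ℝ) (b : Fin 3) : FreeForms →ₐ[ℂ] Matrix (Fin 2) (Fin 2) (Fun q) :=
  FreeAlgebra.lift ℂ (Sum.elim (fun u => !![genFun q u, 0; 0, genFun q u])
    fun u => !![0, innerDer q b (genFun q u); 0, 0])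

theorem evMatFree_fgen (b : Fin 3) (u : Gen) :
    evMatFree q b (fgen u) = !![genFun q u, 0; 0, genFun q u] := by
  simp [evMatFree, fgen]

theorem evMatFree_fdgen (b : Fin 3) (u : Gen) :
    evMatFree q b (fdgen u) = !![0, innerDer q b (genFun q u); 0, 0] := by
  simp [evMatFree, fdgen]

theorem evMatFree_incl (b : Fin 3) (a : FreeAlgebra ℂ Gen) :
    evMatFree q b (incl a) = !![toFun q a, 0; 0, toFun q a] := by
  induction a using FreeAlgebra.induction with
  | grade0 c =>
    rw [AlgHom.commutes, AlgHom.commutes, AlgHom.commutes]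
    ext i j
    fin_cases i <;> fin_cases j <;> simp [Matrix.algebraMap_matrix_apply]
  | grade1 u =>
    rw [incl, FreeAlgebra.lift_ι_apply, evMatFree_fgen]
    rfl
  | mul a a' ha ha' => simp [ha, ha']
  | add a a' ha ha' => simp [ha, ha']

theorem evMatFree_fd_incl (b : Fin 3) (a : FreeAlgebra ℂ Gen) :
    evMatFree q b (fd (incl a)) = !![0, innerDer q b (toFun q a); 0, 0] := by
  induction a using FreeAlgebra.induction with
  | grade0 c =>
    rw [AlgHom.commutes, AlgHom.commutes, fd_algebraMap, innerDer_algebraMap, map_zero]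
    ext i j
    fin_cases i <;> fin_cases j <;> rfl
  | grade1 u =>
    rw [incl, FreeAlgebra.lift_ι_apply, fd_fgen, evMatFree_fdgen]
    rfl
  | mul a a' ha ha' =>
    simp [fd_mul, sgn_incl, evMatFree_incl, ha, ha', innerDer_mul]
  | add a a' ha ha' => simp [ha, ha', innerDer_add]

theorem evMatFree_baseRel (hq : 0 < q) (hq1 : q ≠ 1) (b : Fin 3) {ω η : FreeForms}
    (hr : BaseRel q ω η) : evMatFree q b ω = evMatFree q b η := by
  cases hr with
  | ofFun hr => rw [evMatFree_incl, evMatFree_incl, toFun_rel hr]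
  | x_dx i j =>
    have e : x q i * innerDer q b (x q j) =
        (q : ℂ) • braid q (fun k l => innerDer q b (x q k) * x q l) i j := by
      have e' (k l : Fin 3) : innerDer q b (x q k) * x q l =
          ((q : ℂ) • dil q) • (frameMat q k b * x q l) := by
        rw [innerDer_x hq hq1, smul_mul_assoc, smul_eq_mul, smul_mul_assoc, mul_assoc]
      simp only [e']
      rw [braid_smul (v := fun k l => frameMat q k b * x q l), braid_frameMat_mul_x hq,
        innerDer_x hq hq1, mul_smul_comm, ← mul_assoc, x_dil hq, ← rootq_sq hq, smul_eq_mul,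
        smul_mul_assoc, smul_mul_assoc, mul_assoc]
    simp only [map_mul, map_smul, map_sum, evMatFree_fgen, evMatFree_fdgen, Matrix.mul_fin_two]
    ext k l
    fin_cases k <;> fin_cases l
    · simp [-Complex.coe_smul, Matrix.sum_apply]
    · simp only [braid_apply] at e
      have hx (i : Fin 3) : genFun q (.x i) = x q i := rfl
      simpa [-Complex.coe_smul, Matrix.sum_apply, hx] using e
    · simp [-Complex.coe_smul, Matrix.sum_apply]
    · simp [-Complex.coe_smul, Matrix.sum_apply]
  | d_dil =>
    rw [evMatFree_fdgen, map_zero, show genFun q .dil = dil q from rfl, innerDer_dil hq]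
    ext i j
    fin_cases i <;> fin_cases j <;> rfl
  | rad_dx i =>
    have e : rad q * innerDer q b (x q i) = (q : ℂ) • (innerDer q b (x q i) * rad q) := by
      rw [innerDer_x hq hq1, mul_smul_comm, smul_mul_assoc, ← mul_assoc, rad_dil hq, mul_assoc,
        frameMat_mul_rad, rootq_sq hq, smul_mul_assoc, mul_assoc]
    simp only [map_mul, map_smul, evMatFree_fgen, evMatFree_fdgen, Matrix.mul_fin_two]
    change !![_, rad q * innerDer q b (x q i) + _; _, _] =
      _ • !![_, _ + innerDer q b (x q i) * rad q; _, _]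
    simp [e, -Complex.coe_smul]
  | rad_drad =>
    simp only [map_mul, map_smul, evMatFree_fgen, evMatFree_fdgen, Matrix.mul_fin_two]
    change !![_, rad q * innerDer q b (rad q) + _; _, _] =
      _ • !![_, _ + innerDer q b (rad q) * rad q; _, _]
    simp [rad_mul_innerDer_rad hq, -Complex.coe_smul]

theorem evMatFree_fd_baseRel (b : Fin 3) {ω η : FreeForms} (hr : BaseRel q ω η) :
    evMatFree q b (fd ω) = evMatFree q b (fd η) := by
  cases hr with
  | ofFun hr => rw [evMatFree_fd_incl, evMatFree_fd_incl, toFun_rel hr]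
  | x_dx i j => simp [-Complex.coe_smul, fd_mul, evMatFree_fdgen]
  | d_dil => simp
  | rad_dx i => simp [-Complex.coe_smul, fd_mul, evMatFree_fdgen]
  | rad_drad => simp [-Complex.coe_smul, fd_mul, evMatFree_fdgen]

/-- The matrix `[[f, ω(e_b)], [0, f]]` of a form with parts `f` and `ω` of degree zero and one. -/
def evMat (q : ℝ) (hq : 0 < q) (hq1 : q ≠ 1) (b : Fin 3) :
    Forms q →ₐ[ℂ] Matrix (Fin 2) (Fin 2) (Fun q) :=
  RingQuot.liftAlgHom ℂ ⟨evMatFree q b, fun _ _ hr => by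
    cases hr with
    | base hr => exact evMatFree_baseRel hq hq1 b hr
    | diff hr => exact evMatFree_fd_baseRel b hr⟩

theorem evMat_toForms (hq : 0 < q) (hq1 : q ≠ 1) (b : Fin 3) (ω : FreeForms) :
    evMat q hq hq1 b (toForms q ω) = evMatFree q b ω :=
  RingQuot.liftAlgHom_mkAlgHom_apply ℂ _ _ ω

theorem evMat_ofFun (hq : 0 < q) (hq1 : q ≠ 1) (b : Fin 3) (f : Fun q) :
    evMat q hq hq1 b (ofFun q f) = !![f, 0; 0, f] := by
  obtain ⟨a, rfl⟩ := toFun_surjective q f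
  rw [ofFun_toFun, evMat_toForms, evMatFree_incl]

theorem evMat_d_ofFun (hq : 0 < q) (hq1 : q ≠ 1) (b : Fin 3) (f : Fun q) :
    evMat q hq hq1 b (d q (ofFun q f)) = !![0, innerDer q b f; 0, 0] := by
  obtain ⟨a, rfl⟩ := toFun_surjective q f
  rw [ofFun_toFun, d_toForms, evMat_toForms, evMatFree_fd_incl]

/-- The evaluation `ω ↦ ω(e_b)` of one-forms on the inner derivation `e_b`. -/
def ev (q : ℝ) (hq : 0 < q) (hq1 : q ≠ 1) (b : Fin 3) : OneForms q →ₗ[Fun q] Fun q where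
  toFun ω := evMat q hq hq1 b ω 0 1
  map_add' ω η := by simp
  map_smul' f ω := by
    simp [smul_def, evMat_ofFun, Matrix.mul_apply, Fin.sum_univ_two]

theorem ev_apply (hq : 0 < q) (hq1 : q ≠ 1) (b : Fin 3) (ω : OneForms q) :
    ev q hq hq1 b ω = evMat q hq hq1 b ω 0 1 := rfl

theorem ev_mulRight (hq : 0 < q) (hq1 : q ≠ 1) (b : Fin 3) (ω : OneForms q) (f : Fun q) :
    ev q hq hq1 b (mulRight q ω f) = ev q hq hq1 b ω * f := by
  simp [ev_apply, mulRight, evMat_ofFun, Matrix.mul_apply, Fin.sum_univ_two]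

theorem ev_dFun (hq : 0 < q) (hq1 : q ≠ 1) (b : Fin 3) (f : Fun q) :
    ev q hq hq1 b (dFun q f) = innerDer q b f := by
  rw [ev_apply, coe_dFun, evMat_d_ofFun]
  rfl

theorem ev_ξ (hq : 0 < q) (hq1 : q ≠ 1) (b i : Fin 3) :
    ev q hq hq1 b (ξ q i) = (q : ℂ) • (dil q * frameMat q i b) := by
  rw [ξ, ev_dFun, innerDer_x hq hq1]

theorem ev_θ (hq : 0 < q) (hq1 : q ≠ 1) (a b : Fin 3) :
    ev q hq hq1 b (θ q a) = if a = b then 1 else 0 := by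
  rw [← Matrix.one_apply, ← thetaMat_mul_frameMat hq, Matrix.mul_apply, θ, map_sum]
  refine Finset.sum_congr rfl fun i _ => ?_
  rw [map_smul, ev_ξ, smul_eq_mul, mul_smul_comm, ← mul_assoc, mul_assoc (dilInv q),
    ← smul_mul_assoc, ← mul_smul_comm, thetaMat_mul_dil hq, mul_cancel_assoc dilInv_dil]

theorem eq_sum_ev_smul_θ (hq : 0 < q) (hq1 : q ≠ 1) (ω : OneForms q) :
    ω = ∑ a, ev q hq hq1 a ω • θ q a := by
  obtain ⟨ω, hω⟩ := ω
  induction hω using Submodule.span_induction with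
  | mem ω hω =>
    obtain ⟨f, rfl⟩ := hω
    change dFun q f = ∑ a, ev q hq hq1 a (dFun q f) • θ q a
    simp only [ev_dFun]
    exact dFun_eq_sum hq hq1 f
  | zero =>
    change (0 : OneForms q) = ∑ a, ev q hq hq1 a 0 • θ q a
    simp
  | add ω η hω hη ihω ihη =>
    change (⟨ω, hω⟩ + ⟨η, hη⟩ : OneForms q) =
      ∑ a, ev q hq hq1 a (⟨ω, hω⟩ + ⟨η, hη⟩ : OneForms q) • θ q a
    simp only [map_add, add_smul, Finset.sum_add_distrib]
    rw [← ihω, ← ihη]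
  | smul f ω hω ih =>
    change f • (⟨ω, hω⟩ : OneForms q) =
      ∑ a, ev q hq hq1 a (f • (⟨ω, hω⟩ : OneForms q)) • θ q a
    simp only [map_smul, smul_assoc, ← Finset.smul_sum]
    rw [← ih]

/-- The frame as a basis of the left module of one-forms, with the evaluations on the inner
derivations as coordinates. -/
def frameBasis (q : ℝ) (hq : 0 < q) (hq1 : q ≠ 1) :
    Module.Basis (Fin 3) (Fun q) (OneForms q) :=
  .ofEquivFun
    { LinearMap.pi (ev q hq hq1) with
      invFun := fun c => ∑ a, c a • θ q a
      left_inv := fun ω => (eq_sum_ev_smul_θ hq hq1 ω).symm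
      right_inv := fun c => by
        ext b
        simp [ev_θ] }

theorem frameBasis_apply (hq : 0 < q) (hq1 : q ≠ 1) (a : Fin 3) :
    frameBasis q hq hq1 a = θ q a := by
  rw [frameBasis, Module.Basis.coe_ofEquivFun]
  change ∑ b, (Pi.single a (1 : Fun q) : Fin 3 → Fun q) b • θ q b = _
  simp [Pi.single_apply]

end Evaluation

/-! ### Quadratic relations -/

section Quadratic

variable {q : ℝ}

theorem ξ_mul_ξ (i j : Fin 3) : (ξ q i : Forms q) * (ξ q j : Forms q) =
    -((q : ℂ) • braid q (fun k l => (ξ q k : Forms q) * (ξ q l : Forms q)) i j) := by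
  have dl (i j : Fin 3) : d q (x q i • (ξ q j : Forms q)) =
      (ξ q i : Forms q) * (ξ q j : Forms q) := by
    change d q (ofFun q (x q i) * d q (ofFun q (x q j))) = _
    rw [d_ofFun_mul, d_d, mul_zero, add_zero]
    rfl
  have dr (i j : Fin 3) : d q ((ξ q i : Forms q) * ofFun q (x q j)) =
      -((ξ q i : Forms q) * (ξ q j : Forms q)) := by
    have e : (ξ q i : Forms q) * ofFun q (x q j) =
        d q (ofFun q (x q i * x q j)) - x q i • (ξ q j : Forms q) := by
      rw [d_ofFun_mul_ofFun]
      exact (add_sub_cancel_right _ _).symm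
    rw [e, map_sub, d_d, dl, zero_sub]
  have e := congrArg (d q) (x_smul_ξ (q := q) i j)
  rw [dl, map_smul, braid_apply] at e
  simp only [map_sum, map_smul, dr, smul_neg, Finset.sum_neg_distrib] at e
  exact e

theorem braid_ξ_mul_ξ (hq : 0 < q) :
    braid q (fun i j => (ξ q i : Forms q) * (ξ q j : Forms q)) =
      (-(q : ℂ)⁻¹) • fun i j => (ξ q i : Forms q) * (ξ q j : Forms q) := by
  have hq0 : (q : ℂ) ≠ 0 := by exact_mod_cast hq.ne'
  ext i j
  rw [Pi.smul_apply, Pi.smul_apply, ξ_mul_ξ, neg_smul, smul_neg, smul_smul,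
    inv_mul_cancel₀ hq0, one_smul, neg_neg]

theorem frameMat_dil_mul_frameMat_dil (hq : 0 < q) (i j a b : Fin 3) :
    frameMat q i a * dil q * (frameMat q j b * dil q) =
      (q : ℂ)⁻¹ • (frameMat q i a * frameMat q j b * (dil q * dil q)) := by
  have hq0 : (q : ℂ) ≠ 0 := by exact_mod_cast hq.ne'
  have e : dil q * frameMat q j b = (q : ℂ)⁻¹ • (frameMat q j b * dil q) := by
    rw [frameMat_mul_dil hq, smul_smul, inv_mul_cancel₀ hq0, one_smul]
  rw [mul_assoc, ← mul_assoc (dil q), e, smul_mul_assoc, mul_smul_comm, mul_assoc, mul_assoc]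

theorem sum_sum_comm_sum_sum {M : Type*} [AddCommMonoid M]
    (f : Fin 3 → Fin 3 → Fin 3 → Fin 3 → M) :
    ∑ a, ∑ b, ∑ c, ∑ d, f a b c d = ∑ c, ∑ d, ∑ a, ∑ b, f a b c d := by
  calc ∑ a, ∑ b, ∑ c, ∑ d, f a b c d = ∑ a, ∑ c, ∑ d, ∑ b, f a b c d := by
        refine Finset.sum_congr rfl fun a _ => ?_
        rw [Finset.sum_comm]
        exact Finset.sum_congr rfl fun c _ => Finset.sum_comm
    _ = ∑ c, ∑ d, ∑ a, ∑ b, f a b c d := by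
        rw [Finset.sum_comm]
        exact Finset.sum_congr rfl fun c _ => Finset.sum_comm

theorem ξ_mul_ξ_eq_sum (hq : 0 < q) (i j : Fin 3) :
    (ξ q i : Forms q) * (ξ q j : Forms q) =
      (q : ℂ)⁻¹ • ∑ a, ∑ b, (frameMat q i a * frameMat q j b) •
        (dil q * dil q) • ((θ q a : Forms q) * (θ q b : Forms q)) := by
  have hq0 : (q : ℂ) ≠ 0 := by exact_mod_cast hq.ne'
  rw [coe_ξ_eq_sum_θ hq i, coe_ξ_eq_sum_θ hq j, Finset.sum_mul_sum, Finset.smul_sum]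
  refine Finset.sum_congr rfl fun a _ => ?_
  rw [Finset.smul_sum]
  refine Finset.sum_congr rfl fun b _ => ?_
  rw [smul_mul_assoc, smul_def _ (frameMat q j b * dil q), ← mul_assoc, ← smul_θ hq,
    smul_mul_assoc, smul_smul, frameMat_dil_mul_frameMat_dil hq, smul_assoc, mul_smul]

theorem frameMat_mul_frameMat_smul_eq_zero (hq : 0 < q) {M : Type*} [AddCommGroup M]
    [Module (Fun q) M] {v : Fin 3 → Fin 3 → M}
    (hv : ∀ i j, ∑ a, ∑ b, (frameMat q i a * frameMat q j b) • v a b = 0)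
    (a b : Fin 3) : v a b = 0 := by
  refine frameMat_smul_eq_zero hq (v := fun b => v a b) (fun j => ?_) b
  refine frameMat_smul_eq_zero hq (v := fun a => ∑ b, frameMat q j b • v a b) (fun i => ?_) a
  simpa only [Finset.smul_sum, smul_smul] using hv i j

/-- The products of the frame satisfy the same quadratic relations as the differentials of the
coordinates, because the matrix `e^i_a` satisfies the `RTT`-relations. -/
theorem braid_θ_mul_θ (hq : 0 < q) :
    braid q (fun a b => (θ q a : Forms q) * (θ q b : Forms q)) =
      (-(q : ℂ)⁻¹) • fun a b => (θ q a : Forms q) * (θ q b : Forms q) := by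
  have hq0 : (q : ℂ) ≠ 0 := by exact_mod_cast hq.ne'
  set V : Fin 3 → Fin 3 → Forms q := fun a b => (θ q a : Forms q) * (θ q b : Forms q) with hV
  have hξ (i j : Fin 3) : ∑ a, ∑ b, (frameMat q i a * frameMat q j b) • (dil q * dil q) • V a b =
      (q : ℂ) • ((ξ q i : Forms q) * (ξ q j : Forms q)) := by
    rw [ξ_mul_ξ_eq_sum hq, smul_smul, mul_inv_cancel₀ hq0, one_smul]
  have hb (i j : Fin 3) :
      ∑ a, ∑ b, (frameMat q i a * frameMat q j b) • (dil q * dil q) • braid q V a b =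
        braid q (fun k l => ∑ a, ∑ b,
          (frameMat q k a * frameMat q l b) • (dil q * dil q) • V a b) i j := by
    have e (c d : Fin 3) : braid q (fun k l => (frameMat q k c * frameMat q l d) •
        (dil q * dil q) • V c d) i j =
        ∑ a, ∑ b, (frameMat q i a * frameMat q j b) • (dil q * dil q) •
          Rhat q (a, b) (c, d) • V c d := by
      rw [braid_smul_const (fun k l => frameMat q k c * frameMat q l d),
        braid_frameMat_mul_frameMat hq, braid_apply]
      simp only [Finset.sum_smul, smul_assoc, Rhat_symm q c d, smul_comm _ (Rhat q _ _)]
    simp only [braid_sum, e]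
    simp only [braid_apply, Finset.smul_sum]
    exact sum_sum_comm_sum_sum fun a b c d => (frameMat q i a * frameMat q j b) •
      (dil q * dil q) • Rhat q (a, b) (c, d) • V c d
  ext a b
  have key := frameMat_mul_frameMat_smul_eq_zero hq
    (v := fun a b => (dil q * dil q) • (V a b + (q : ℂ) • braid q V a b)) (fun i j => by
      simp only [smul_add, Finset.sum_add_distrib, smul_comm _ (q : ℂ), ← Finset.smul_sum, hb, hξ]
      rw [braid_smul (v := fun k l => (ξ q k : Forms q) * (ξ q l : Forms q)), ← smul_add,
        ξ_mul_ξ i j, neg_add_cancel, smul_zero]) a b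
  rw [mul_smul] at key
  have key' := eq_neg_of_add_eq_zero_left (eq_zero_of_dil_smul (eq_zero_of_dil_smul key))
  rw [Pi.smul_apply, Pi.smul_apply, key', neg_smul, smul_neg, neg_neg, smul_smul,
    inv_mul_cancel₀ hq0, one_smul]

end Quadratic

/-! ### The metric -/

section MetricSection

variable {q : ℝ}

theorem mulRight_θ (hq : 0 < q) (a : Fin 3) (f : Fun q) :
    mulRight q (θ q a) f = f • θ q a :=
  Subtype.ext (smul_θ hq a f).symm

/-- The metric which is constant on the frame. -/
def frameMetric (q : ℝ) (hq : 0 < q) (hq1 : q ≠ 1) : Metric q where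
  val ω η := ∑ a, ∑ b, ((q : ℂ) * g q a b) • (ev q hq hq1 a ω * ev q hq hq1 b η)
  add_left ω ω' η := by simp only [map_add, add_mul, smul_add, Finset.sum_add_distrib]
  add_right ω η η' := by simp only [map_add, mul_add, smul_add, Finset.sum_add_distrib]
  balanced ω f η := by simp only [ev_mulRight, map_smul, smul_eq_mul, mul_assoc]
  smul_left f ω η := by
    simp only [map_smul, smul_eq_mul, mul_assoc, Finset.mul_sum, mul_smul_comm]
  mul_right ω η f := by
    simp only [ev_mulRight, Finset.sum_mul, smul_mul_assoc, mul_assoc]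

theorem frameMetric_θ (hq : 0 < q) (hq1 : q ≠ 1) (a b : Fin 3) :
    (frameMetric q hq hq1).val (θ q a) (θ q b) =
      algebraMap ℂ (Fun q) ((q : ℂ) * g q a b) := by
  simp only [frameMetric, ev_θ, Algebra.algebraMap_eq_smul_one]
  simp [-Complex.coe_smul]

theorem frameMetric_ξ (hq : 0 < q) (hq1 : q ≠ 1) (i j : Fin 3) :
    (frameMetric q hq hq1).val (ξ q i) (ξ q j) = g q i j • (rad q ^ 2 * dil q ^ 2) := by
  have hq0 : (q : ℂ) ≠ 0 := by exact_mod_cast hq.ne'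
  have e (a b : Fin 3) : ((q : ℂ) * g q a b) •
      (ev q hq hq1 a (ξ q i) * ev q hq hq1 b (ξ q j)) =
      g q a b • (frameMat q i a * frameMat q j b) * (dil q * dil q) := by
    rw [ev_ξ, ev_ξ, ← frameMat_mul_dil hq, ← frameMat_mul_dil hq,
      frameMat_dil_mul_frameMat_dil hq, smul_smul, mul_right_comm, mul_inv_cancel₀ hq0, one_mul,
      smul_mul_assoc]
  change ∑ a, ∑ b, ((q : ℂ) * g q a b) • (ev q hq hq1 a (ξ q i) * ev q hq hq1 b (ξ q j)) = _
  simp only [e, ← Finset.sum_mul, sum_g_frameMat_lower hq]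
  rw [smul_mul_assoc, pow_two (dil q)]

@[ext] theorem Metric.ext {G G' : Metric q} (hG : ∀ ω η, G.val ω η = G'.val ω η) : G = G' := by
  cases G
  cases G'
  simp only [Metric.mk.injEq]
  funext ω η
  exact hG ω η

theorem Metric.val_sum_left (G : Metric q) (c : Fin 3 → Fun q) (ω : Fin 3 → OneForms q)
    (η : OneForms q) : G.val (∑ a, c a • ω a) η = ∑ a, c a * G.val (ω a) η := by
  simp only [Fin.sum_univ_three, G.add_left, G.smul_left]

theorem Metric.val_sum_right (hq : 0 < q) (G : Metric q) (c : Fin 3 → Fun q) (a : Fin 3) :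
    G.val (θ q a) (∑ b, c b • θ q b) = ∑ b, c b * G.val (θ q a) (θ q b) := by
  simp only [Fin.sum_univ_three, G.add_right, ← G.balanced, mulRight_θ hq, G.smul_left]

theorem Metric.val_sum_sum (hq : 0 < q) (G : Metric q) (c c' : Fin 3 → Fun q) :
    G.val (∑ a, c a • θ q a) (∑ b, c' b • θ q b) =
      ∑ a, ∑ b, c a * c' b * G.val (θ q a) (θ q b) := by
  simp only [G.val_sum_left, G.val_sum_right hq, Finset.mul_sum, mul_assoc]

theorem ξ_eq_sum_θ (hq : 0 < q) (i : Fin 3) :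
    ξ q i = ∑ a, (frameMat q i a * dil q) • θ q a :=
  Subtype.ext ((coe_ξ_eq_sum_θ hq i).trans (by simp))

/-- A metric is determined by its values on the differentials of the coordinates: the coefficients
can be moved through the frame, so it is determined by its values on the frame, and the matrix
`e^i_a` is invertible. -/
theorem Metric.eq_of_val_ξ (hq : 0 < q) (hq1 : q ≠ 1) {G G' : Metric q}
    (hG : ∀ i j, G.val (ξ q i) (ξ q j) = G'.val (ξ q i) (ξ q j)) : G = G' := by
  have hq0 : (q : ℂ) ≠ 0 := by exact_mod_cast hq.ne'
  have hθ (a b : Fin 3) : G.val (θ q a) (θ q b) = G'.val (θ q a) (θ q b) := by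
    refine sub_eq_zero.1 (eq_zero_of_dil_smul (q := q) (eq_zero_of_dil_smul (q := q) ?_))
    refine frameMat_mul_frameMat_smul_eq_zero hq (v := fun a b => dil q • dil q •
      (G.val (θ q a) (θ q b) - G'.val (θ q a) (θ q b))) (fun i j => ?_) a b
    have e := hG i j
    rw [ξ_eq_sum_θ hq i, ξ_eq_sum_θ hq j, G.val_sum_sum hq, G'.val_sum_sum hq] at e
    simp only [frameMat_dil_mul_frameMat_dil hq, smul_mul_assoc, ← Finset.smul_sum] at e
    have e' := smul_right_injective _ (inv_ne_zero hq0) e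
    simp only [smul_eq_mul, mul_sub, Finset.sum_sub_distrib, sub_eq_zero]
    simpa only [mul_assoc] using e'
  ext ω η
  rw [eq_sum_ev_smul_θ hq hq1 ω, eq_sum_ev_smul_θ hq hq1 η, G.val_sum_sum hq, G'.val_sum_sum hq]
  simp only [hθ]

end MetricSection

end QEuclid

end

theorem mainTheorem4 (q : ℝ) (hq : 0 < q) (hq1 : q ≠ 1) :
    -- the one-forms commute with the algebra and form a basis
    (∀ (a : Fin 3) (f : QEuclid.Fun q), f • QEuclid.θ q a = QEuclid.mulRight q (QEuclid.θ q a) f) ∧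
    (∃ B : Module.Basis (Fin 3) (QEuclid.Fun q) (QEuclid.OneForms q), ∀ a, B a = QEuclid.θ q a) ∧
    -- duality with the inner derivations, whose evaluation on one-forms is left linear with
    -- value `e_b f` on `df`
    (∃ ev : Fin 3 → (QEuclid.OneForms q →ₗ[QEuclid.Fun q] QEuclid.Fun q),
      (∀ b f, ev b (QEuclid.dFun q f) = QEuclid.innerDer q b f) ∧
      ∀ a b, ev b (QEuclid.θ q a) = if a = b then 1 else 0) ∧
    (∀ f, QEuclid.dFun q f = ∑ a, QEuclid.innerDer q a f • QEuclid.θ q a) ∧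
    -- the inverse matrix, the RTT and the gTT relations
    (∃ e : Matrix (Fin 3) (Fin 3) (QEuclid.Fun q),
      QEuclid.thetaMat q * e = 1 ∧ e * QEuclid.thetaMat q = 1 ∧
      (∀ a i, QEuclid.innerDer q a (QEuclid.x q i) = (q : ℂ) • (QEuclid.dil q * e i a)) ∧
      (∀ i j a b, ∑ k, ∑ l, QEuclid.Rhat q (i, j) (k, l) • (e k a * e l b) =
        ∑ c, ∑ d, QEuclid.Rhat q (c, d) (a, b) • (e i c * e j d)) ∧
      (∀ i j, ∑ a, ∑ b, QEuclid.g q a b • (e i a * e j b) =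
        QEuclid.g q i j • QEuclid.rad q ^ 2) ∧
      (∀ a b, ∑ i, ∑ j, QEuclid.g q i j • (e i a * e j b) =
        QEuclid.g q a b • QEuclid.rad q ^ 2)) ∧
    -- the quadratic relations, for the frame and for the differentials of the coordinates
    (∀ a b, ∑ c, ∑ d, QEuclid.Pt q (a, b) (c, d) •
      ((QEuclid.θ q c : QEuclid.Forms q) * (QEuclid.θ q d : QEuclid.Forms q)) = 0) ∧
    (∀ a b, ∑ c, ∑ d, QEuclid.Ps q (a, b) (c, d) •
      ((QEuclid.θ q c : QEuclid.Forms q) * (QEuclid.θ q d : QEuclid.Forms q)) = 0) ∧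
    (∀ i j, ∑ k, ∑ l, QEuclid.Pt q (i, j) (k, l) •
      ((QEuclid.ξ q k : QEuclid.Forms q) * (QEuclid.ξ q l : QEuclid.Forms q)) = 0) ∧
    (∀ i j, ∑ k, ∑ l, QEuclid.Ps q (i, j) (k, l) •
      ((QEuclid.ξ q k : QEuclid.Forms q) * (QEuclid.ξ q l : QEuclid.Forms q)) = 0) ∧
    -- the metric and its values on the frame
    (∃! G : QEuclid.Metric q, ∀ i j, G.val (QEuclid.ξ q i) (QEuclid.ξ q j) =
      QEuclid.g q i j • (QEuclid.rad q ^ 2 * QEuclid.dil q ^ 2)) ∧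
    (∀ G : QEuclid.Metric q,
      (∀ i j, G.val (QEuclid.ξ q i) (QEuclid.ξ q j) =
        QEuclid.g q i j • (QEuclid.rad q ^ 2 * QEuclid.dil q ^ 2)) →
      ∀ a b, G.val (QEuclid.θ q a) (QEuclid.θ q b) =
        algebraMap ℂ (QEuclid.Fun q) ((q : ℂ) * QEuclid.g q a b)) := by
  have hξv := QEuclid.braid_ξ_mul_ξ hq
  have hθv := QEuclid.braid_θ_mul_θ hq
  refine ⟨fun a f => (QEuclid.mulRight_θ hq a f).symm,
    ⟨QEuclid.frameBasis q hq hq1, QEuclid.frameBasis_apply hq hq1⟩,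
    ⟨QEuclid.ev q hq hq1, QEuclid.ev_dFun hq hq1, QEuclid.ev_θ hq hq1⟩,
    QEuclid.dFun_eq_sum hq hq1,
    ⟨QEuclid.frameMat q, QEuclid.thetaMat_mul_frameMat hq, QEuclid.frameMat_mul_thetaMat hq,
      QEuclid.innerDer_x hq hq1, fun i j a b => ?_, QEuclid.sum_g_frameMat_lower hq,
      QEuclid.sum_g_frameMat_upper hq⟩,
    fun a b => congrFun (congrFun (QEuclid.contract_Pt_eq_zero _ hθv) a) b,
    fun a b => congrFun (congrFun (QEuclid.contract_Ps_eq_zero _ hθv) a) b,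
    fun i j => congrFun (congrFun (QEuclid.contract_Pt_eq_zero _ hξv) i) j,
    fun i j => congrFun (congrFun (QEuclid.contract_Ps_eq_zero _ hξv) i) j,
    ⟨QEuclid.frameMetric q hq hq1, QEuclid.frameMetric_ξ hq hq1, fun G hG =>
      QEuclid.Metric.eq_of_val_ξ hq hq1 fun i j => ?_⟩, fun G hG a b => ?_⟩
  · simpa only [QEuclid.braid_apply, QEuclid.Rhat_symm q a b] using
      QEuclid.braid_frameMat_mul_frameMat hq i j a b
  · rw [hG, QEuclid.frameMetric_ξ hq hq1]
  · have e : G = QEuclid.frameMetric q hq hq1 :=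
      QEuclid.Metric.eq_of_val_ξ hq hq1 fun i j => by rw [hG, QEuclid.frameMetric_ξ hq hq1]
    rw [e, QEuclid.frameMetric_θ hq hq1]
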